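/- Let $A$ be a finite alphabet, $A^+$ the free semigroup on $A$, and $\widehat{F}_S(A)$, $\widehat{F}_G(A)$ the free profinite semigroup and the free profinite group on $A$. Let $\varphi$ be a substitution over $A$, i.e. an endomorphism of $A^+$; denote also by $\varphi$ its continuous extension to $\widehat{F}_S(A)$, and by $\varphi_G$ the continuous endomorphism of $\widehat{F}_G(A)$ with $\varphi_G(c)=\varphi(c)$ for $c\in A$. For a continuous endomorphism $f$ of a finitely generated profinite semigroup or group put $f^\omega=\lim_n f^{n!}$ (pointwise). Assume that $\varphi$ is weakly primitive: for some $n\ge 1$, all words $\varphi^n(c)$ ($c\in A$) have length at least two and the same factors of length two. Let $L$ be the language of the subshift of $\varphi$, i.e. the set of words that are factors of $\varphi^k(c)$ for some $c\in A$ and all sufficiently large $k$. Assume that $\varphi$ is ultimately group invertible: if $B$ is the set of letters that occur in some $\varphi^\omega(c)$ with $c\in A$, then $\varphi_G$ restricts to an automorphism of $\widehat{F}_G(B)\subseteq\widehat{F}_G(A)$. Let $ba$ ($a,b\in A$) be a connection for $\varphi$: $ba\in L$, the first letter of $\varphi^\omega(a)$ is $a$, and the last letter of $\varphi^\omega(b)$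 is $b$. Let $G(\varphi)$ be the intersection of the $\mathcal R$-class of $\varphi^\omega(a)$ with the $\mathcal L$-class of $\varphi^\omega(b)$ in $\widehat{F}_S(A)$. Let $R(ba)$ be the set of return words of $ba$, i.e. of nonempty words $v$ such that $vba\in L$, $ba$ is a prefix of $vba$, and $ba$ occurs in $vba$ only as a prefix and as a suffix. Let $X=b^{-1}R(ba)b$. Then $X$ is finite and freely generates a subsemigroup of $A^+$, and there is $m\ge1$ such that $\tilde\varphi=\varphi^m$ has the property that $\tilde\varphi(a)$ starts with $a$ and $\tilde\varphi(b)$ ends with $b$. For every such $m$, each $\tilde\varphi(x)$ with $x\in X$ is a product of elements of $X$; let $w_x$ be this (unique) factorization, regarded as a word over $X$, and let $\tilde\varphi_{X,G}$ be the continuous endomorphism of $\widehat{F}_G(X)$ with $\tilde\varphi_{X,G}(x)=w_x$. Then $G(\varphi)$ is a group, and it admits, as a profinite group, the presentation $$\langle X \mid (\tilde\varphi_{X,G})^\omega(x)=x\ (x\in X)\rangle,$$ where the generator $x$ stands for the element $\varphi^\omega(x)$ of $G(\varphi)$. -/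

import Mathlib

open Filter Topology

universe u

noncomputable section

namespace Subst

/-! ### The free profinite semigroup -/

/-- The congruences of finite index on the free semigroup `A⁺`. -/
def FinCon (A : Type u) : Type u := {c : Con (FreeSemigroup A) // Finite c.Quotient}

/-- The finite quotient semigroup of `A⁺` given by a congruence of finite index. -/
def FinQuot {A : Type u} (c : FinCon A) : Type u := c.1.Quotient

instance {A : Type u} (c : FinCon A) : Semigroup (FinQuot c) :=
  inferInstanceAs (Semigroup c.1.Quotient)

instance {A : Type u} (c : FinCon A) : Finite (FinQuot c) := c.2

instance {A : Type u} (c : FinCon A) : TopologicalSpace (FinQuot c) := ⊥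

instance {A : Type u} (c : FinCon A) : DiscreteTopology (FinQuot c) := ⟨rfl⟩

/-- The diagonal homomorphism from `A⁺` to the product of its finite quotients. -/
def diag (A : Type u) : FreeSemigroup A →ₙ* (∀ c : FinCon A, FinQuot c) where
  toFun w := fun c => (Quotient.mk'' w : c.1.Quotient)
  map_mul' _ _ := rfl

/-- The free profinite semigroup on `A`: the profinite completion of `A⁺`, realized as the closure
of the image of `A⁺` in the product of its finite (discrete) quotients. -/
abbrev ProSemi (A : Type u) : Type u := (diag A).srange.topologicalClosure

instance (A : Type u) : CompactSpace (ProSemi A) :=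
  isCompact_iff_compactSpace.mp (diag A).srange.isClosed_topologicalClosure.isCompact

/-- A word regarded as an element of the free profinite semigroup. -/
def word {A : Type u} : FreeSemigroup A →ₙ* ProSemi A where
  toFun w := ⟨diag A w, subset_closure ⟨w, rfl⟩⟩
  map_mul' w v := Subtype.ext (map_mul (diag A) w v)

/-- The pullback of a finite-index congruence along a homomorphism. -/
def FinCon.comap {A B : Type u} (f : FreeSemigroup A →ₙ* FreeSemigroup B) (c : FinCon B) :
    FinCon A :=
  ⟨c.1.comap f (map_mul f), by
    have := c.2
    refine Finite.of_injective (β := c.1.Quotient)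
      (fun q => Quotient.map' f (fun _ _ h => h) q) ?_
    rintro ⟨x⟩ ⟨y⟩ h
    exact Quotient.sound' (Quotient.exact' (s₁ := c.1.toSetoid) (a := f x) (b := f y) h)⟩

/-- The homomorphism between finite quotients induced by `f : A⁺ → B⁺`. -/
def quotMap {A B : Type u} (f : FreeSemigroup A →ₙ* FreeSemigroup B) (c : FinCon B) :
    FinQuot (c.comap f) →ₙ* FinQuot c where
  toFun q := Quotient.map' f (fun _ _ h => h) q
  map_mul' := by
    rintro ⟨p⟩ ⟨q⟩
    exact congrArg (fun t => (Quotient.mk'' t : c.1.Quotient)) (map_mul f p q)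

/-- The homomorphism between products of finite quotients induced by `f : A⁺ → B⁺`. -/
def prodMap {A B : Type u} (f : FreeSemigroup A →ₙ* FreeSemigroup B) :
    (∀ c : FinCon A, FinQuot c) →ₙ* (∀ c : FinCon B, FinQuot c) where
  toFun x := fun c => quotMap f c (x (c.comap f))
  map_mul' _ _ := funext fun c => map_mul (quotMap f c) _ _

theorem continuous_prodMap {A B : Type u} (f : FreeSemigroup A →ₙ* FreeSemigroup B) :
    Continuous (prodMap f) :=
  continuous_pi fun c => continuous_of_discreteTopology.comp (continuous_apply (c.comap f))

/-- The continuous extension of a homomorphism `A⁺ → B⁺` to the free profinite semigroups. -/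
def extend {A B : Type u} (f : FreeSemigroup A →ₙ* FreeSemigroup B) :
    ProSemi A →ₙ* ProSemi B where
  toFun x := ⟨prodMap f x.1, by
    have h : Set.MapsTo (prodMap f) ((diag A).srange : Set _) ((diag B).srange : Set _) := by
      rintro _ ⟨w, rfl⟩
      exact ⟨f w, rfl⟩
    exact h.closure (continuous_prodMap f) x.2⟩
  map_mul' x y := Subtype.ext (map_mul (prodMap f) x.1 y.1)

theorem continuous_extend {A B : Type u} (f : FreeSemigroup A →ₙ* FreeSemigroup B) :
    Continuous (extend f) :=
  ((continuous_prodMap f).comp continuous_subtype_val).subtype_mk _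

theorem extend_word {A B : Type u} (f : FreeSemigroup A →ₙ* FreeSemigroup B)
    (w : FreeSemigroup A) : extend f (word w) = word (f w) := rfl

/-! ### The free profinite group -/

/-- The free profinite group on a (finite) set `X`: the profinite completion of the free group. -/
abbrev ProGrp (X : Type u) : Type u :=
  ProfiniteGrp.ProfiniteCompletion.completion (GrpCat.of (FreeGroup X))

/-- An element of the free group regarded as an element of the free profinite group. -/
def gword {X : Type u} (g : FreeGroup X) : ProGrp X :=
  ProfiniteGrp.ProfiniteCompletion.etaFn (GrpCat.of (FreeGroup X)) g

/-- The continuous homomorphism of free profinite groups induced by one of free groups. -/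
def gextend {X Y : Type u} (f : FreeGroup X →* FreeGroup Y) : ProGrp X →ₜ* ProGrp Y :=
  (ProfiniteGrp.profiniteCompletion.map (GrpCat.ofHom f)).hom

/-- A semigroup word regarded as a group word. -/
def toGroup {X : Type u} : FreeSemigroup X →ₙ* FreeGroup X :=
  FreeSemigroup.lift FreeGroup.of

/-- The continuous endomorphism of the free profinite group on `X` that sends each
generator `x` to the word `w x`. -/
def groupEndo {X : Type u} (w : X → FreeSemigroup X) : ProGrp X →ₜ* ProGrp X :=
  gextend (FreeGroup.lift fun x => toGroup (w x))

/-! ### The idempotent iterate -/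

/-- The `ω`-power `f^ω = lim f^{n!}` (pointwise) of a continuous endomorphism `f`. -/
def omega {S : Type u} [TopologicalSpace S] (f : S → S) (x : S) : S :=
  haveI : Nonempty S := ⟨x⟩
  limUnder atTop fun n : ℕ => f^[n.factorial] x

/-- A sequence in a compact space converges if each of a separating family of continuous maps
to discrete spaces is eventually constant along it. -/
theorem exists_tendsto_of_eventually {S : Type u} [TopologicalSpace S] [CompactSpace S] {ι : Type u}
    {Q : ι → Type u} [∀ i, TopologicalSpace (Q i)] [∀ i, DiscreteTopology (Q i)]
    (ψ : ∀ i, S → Q i) (hψ : ∀ i, Continuous (ψ i)) (hsep : ∀ x y, (∀ i, ψ i x = ψ i y) → x = y)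
    (s : ℕ → S) (hs : ∀ i, ∃ q, ∀ᶠ n in atTop, ψ i (s n) = q) :
    ∃ y, Tendsto s atTop (𝓝 y) := by
  obtain ⟨y, hy⟩ := exists_clusterPt_of_compactSpace (map s atTop)
  refine ⟨y, ?_⟩
  have hemb : IsEmbedding fun x i => ψ i x :=
    ((continuous_pi hψ).isClosedEmbedding
      fun x y h => hsep x y fun i => congrFun h i).isEmbedding
  rw [hemb.tendsto_nhds_iff, tendsto_pi_nhds]
  intro i
  obtain ⟨q, hq⟩ := hs i
  have hyq : ψ i y = q := by
    have hopen : IsOpen (ψ i ⁻¹' {ψ i y}) := (isOpen_discrete _).preimage (hψ i)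
    have hfr : ∃ᶠ n in atTop, s n ∈ ψ i ⁻¹' {ψ i y} :=
      (mapClusterPt_iff_frequently.mp hy) _ (hopen.mem_nhds rfl)
    obtain ⟨n, h1, h2⟩ := (hfr.and_eventually hq).exists
    exact h1.symm.trans h2
  exact tendsto_nhds_of_eventually_eq (hq.mono fun n hn => hn.trans hyq.symm)

/-- If only finitely many maps occur among the `ψ ∘ fᵏ`, then `ψ (f^{n!} x)` is eventually
constant. -/
theorem eventually_factorial {S Q T : Type u} [Finite T] (f : S → S) (ψ : S → Q) (τ : ℕ → T)
    (h : ∀ i j, τ i = τ j → ∀ z, ψ (f^[i] z) = ψ (f^[j] z)) (x : S) :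
    ∃ q, ∀ᶠ n : ℕ in atTop, ψ (f^[n.factorial] x) = q := by
  obtain ⟨i, p, hp, hip⟩ : ∃ i p, 0 < p ∧ τ i = τ (i + p) := by
    obtain ⟨i, j, hne, hij⟩ := Finite.exists_ne_map_eq_of_infinite τ
    rcases lt_or_gt_of_ne hne with hlt | hlt
    · exact ⟨i, j - i, by omega, by rw [hij]; congr 1; omega⟩
    · exact ⟨j, i - j, by omega, by rw [← hij]; congr 1; omega⟩
  have hstep : ∀ k, i ≤ k → ψ (f^[k + p] x) = ψ (f^[k] x) := by
    intro k hk
    obtain ⟨d, rfl⟩ := Nat.exists_eq_add_of_le hk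
    have := h i (i + p) hip (f^[d] x)
    rw [← Function.iterate_add_apply, ← Function.iterate_add_apply] at this
    rw [this]
    congr 2
    omega
  have hmul : ∀ t k, i ≤ k → ψ (f^[k + p * t] x) = ψ (f^[k] x) := by
    intro t
    induction t with
    | zero => intro k _; rfl
    | succ t ih =>
      intro k hk
      rw [Nat.mul_succ, ← Nat.add_assoc, hstep _ (by omega), ih k hk]
  refine ⟨ψ (f^[(i + p).factorial] x), ?_⟩
  filter_upwards [eventually_ge_atTop (i + p)] with n hn
  have h1 : i ≤ (i + p).factorial := le_trans (by omega) (Nat.self_le_factorial _)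
  obtain ⟨t, ht⟩ : p ∣ n.factorial - (i + p).factorial :=
    Nat.dvd_sub (Nat.dvd_factorial hp (by omega)) (Nat.dvd_factorial hp (by omega))
  have h2 : n.factorial = (i + p).factorial + p * t := by
    have := Nat.factorial_le hn
    omega
  rw [h2, hmul t _ h1]

theorem denseRange_word {A : Type u} : DenseRange (word (A := A)) := by
  intro x
  rw [closure_subtype]
  refine closure_mono ?_ x.2
  rintro _ ⟨w, rfl⟩
  exact ⟨word w, ⟨w, rfl⟩, rfl⟩

/-- The limit that defines `f^ω` exists for the endomorphisms of a free profinite semigroup on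
a finite set that come from substitutions. -/
theorem tendsto_omega_extend {A : Type u} [Finite A] (f : FreeSemigroup A →ₙ* FreeSemigroup A)
    (x : ProSemi A) :
    Tendsto (fun n : ℕ => (extend f)^[n.factorial] x) atTop (𝓝 (omega (extend f) x)) := by
  have : Nonempty (ProSemi A) := ⟨x⟩
  refine tendsto_nhds_limUnder (exists_tendsto_of_eventually
    (fun (c : FinCon A) (z : ProSemi A) => z.1 c)
    (fun c => (continuous_apply c).comp continuous_subtype_val)
    (fun y z h => Subtype.ext (funext h)) _ fun c => ?_)
  refine eventually_factorial (T := A → FinQuot c) _ (fun z : ProSemi A => z.1 c)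
    (fun k d => ((extend f)^[k] (word (FreeSemigroup.of d))).1 c) (fun i j hij z => ?_) x
  have hmul : ∀ (k : ℕ) (y z : ProSemi A), ((extend f)^[k] (y * z)).1 c =
      ((extend f)^[k] y).1 c * ((extend f)^[k] z).1 c := fun k y z => by
    rw [iterate_map_mul]; rfl
  have hcont : ∀ k : ℕ, Continuous fun z : ProSemi A => ((extend f)^[k] z).1 c := fun k =>
    ((continuous_apply c).comp continuous_subtype_val).comp ((continuous_extend f).iterate k)
  refine congrFun (denseRange_word.equalizer (hcont i) (hcont j) (funext fun w => ?_)) z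
  induction w using FreeSemigroup.recOnMul with
  | ih1 d => exact congrFun hij d
  | ih2 d w h1 h2 =>
    simp only [Function.comp_apply] at h1 h2 ⊢
    rw [map_mul, hmul, hmul, h1, h2]

theorem gextend_gword {X Y : Type u} (f : FreeGroup X →* FreeGroup Y) (g : FreeGroup X) :
    gextend f (gword g) = gword (f g) :=
  CategoryTheory.ConcreteCategory.congr_hom (ProfiniteGrp.ProfiniteCompletion.lift_eta
    (CategoryTheory.CategoryStruct.comp (GrpCat.ofHom f) <|
      ProfiniteGrp.ProfiniteCompletion.eta (GrpCat.of (FreeGroup Y)))) g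

/-- The limit that defines `f^ω` exists for the continuous endomorphisms of a free profinite
group on a finite set. -/
theorem tendsto_omega_grp {X : Type u} [Finite X] (f : ProGrp X →ₜ* ProGrp X) (x : ProGrp X) :
    Tendsto (fun n : ℕ => f^[n.factorial] x) atTop (𝓝 (omega f x)) := by
  have : Nonempty (ProGrp X) := ⟨x⟩
  let Q : FiniteIndexNormalSubgroup (FreeGroup X) → Type u := fun N => FreeGroup X ⧸ N.toSubgroup
  let iT : ∀ N, TopologicalSpace (Q N) := fun _ => ⊥
  have iD : ∀ N, DiscreteTopology (Q N) := fun _ => ⟨rfl⟩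
  have hc : ∀ N, Continuous fun z : ProGrp X => (z.1 N : Q N) := fun N =>
    (continuous_apply N).comp continuous_subtype_val
  refine tendsto_nhds_limUnder (exists_tendsto_of_eventually (Q := Q)
    (fun N (z : ProGrp X) => (z.1 N : Q N)) hc
    (fun y z h => Subtype.ext (funext h)) _ fun N => ?_)
  have : Finite (Q N) := inferInstanceAs (Finite (FreeGroup X ⧸ N.toSubgroup))
  let pr : ProGrp X →* Q N :=
    { toFun := fun z => z.1 N, map_one' := rfl, map_mul' := fun _ _ => rfl }
  let iter : ℕ → ProGrp X →* ProGrp X := fun k =>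
    { toFun := f^[k], map_one' := iterate_map_one f k, map_mul' := iterate_map_mul f k }
  let gw : FreeGroup X →* ProGrp X :=
    { toFun := gword, map_one' := rfl, map_mul' := fun _ _ => rfl }
  refine eventually_factorial (T := X → Q N) _ pr
    (fun k d => pr (f^[k] (gword (FreeGroup.of d)))) (fun i j hij z => ?_) x
  have key : (pr.comp (iter i)).comp gw = (pr.comp (iter j)).comp gw := by
    ext d
    exact congrFun hij d
  have hcont : ∀ k : ℕ, Continuous fun z : ProGrp X => pr (f^[k] z) := fun k =>
    (hc N).comp (f.continuous_toFun.iterate k)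
  refine congrFun ((ProfiniteGrp.ProfiniteCompletion.denseRange
    (GrpCat.of (FreeGroup X))).equalizer (hcont i) (hcont j) (funext fun w => ?_)) z
  exact DFunLike.congr_fun key w

/-! ### Substitutions -/

/-- The list of letters of a nonempty word. -/
def letters {A : Type u} (w : FreeSemigroup A) : List A := w.head :: w.tail

/-- `φ` is weakly primitive: for some `n ≥ 1`, all `φⁿ(a)` have length at least two and
the same factors of length two. -/
def IsWeaklyPrimitive {A : Type u} (φ : FreeSemigroup A →ₙ* FreeSemigroup A) : Prop :=
  ∃ n : ℕ, 0 < n ∧ (∀ a, 2 ≤ (φ^[n] (FreeSemigroup.of a)).length) ∧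
    ∀ a b, ∀ u : List A, u.length = 2 →
      (u <:+: letters (φ^[n] (FreeSemigroup.of a)) ↔
        u <:+: letters (φ^[n] (FreeSemigroup.of b)))

/-- The language of blocks of the subshift of `φ`: the words that are factors of `φᵏ(c)`,
for some letter `c` and all sufficiently large `k`. -/
def language {A : Type u} (φ : FreeSemigroup A →ₙ* FreeSemigroup A) : Set (List A) :=
  {u | ∃ c, ∀ᶠ k : ℕ in atTop, u <:+: letters (φ^[k] (FreeSemigroup.of c))}

/-- The return words of `u` in a language `L`: the nonempty words `v` such that `vu ∈ L`, `u` is a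
prefix of `vu`, and `u` occurs in `vu` only as a prefix and as a suffix. -/
def returnWords {A : Type u} (L : Set (List A)) (u : List A) : Set (List A) :=
  {v | v ≠ [] ∧ v ++ u ∈ L ∧ u <+: v ++ u ∧ ∀ s t, v ++ u = s ++ u ++ t → s = [] ∨ t = []}

/-- The set `X = b⁻¹ R(ba) b`, with `R(ba)` the set of return words of `ba`. -/
def shiftedReturns {A : Type u} (φ : FreeSemigroup A →ₙ* FreeSemigroup A) (b a : A) :
    Set (FreeSemigroup A) :=
  {x | ∃ r ∈ returnWords (language φ) [b, a], b :: letters x = r ++ [b]}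

/-- The homomorphism `X⁺ → A⁺` that sends each generator `x ∈ X` to the word `x`. -/
def inclX {A : Type u} (X : Set (FreeSemigroup A)) : FreeSemigroup X →ₙ* FreeSemigroup A :=
  FreeSemigroup.lift Subtype.val

/-- `φ^ω`, the idempotent iterate of the continuous extension of `φ` to the free profinite
semigroup. -/
def subOmega {A : Type u} (φ : FreeSemigroup A →ₙ* FreeSemigroup A) : ProSemi A → ProSemi A :=
  omega (extend φ)

/-- `y` is a prefix of `x`, that is `x ∈ y S¹`. -/
def IsPrefixOf {S : Type u} [Semigroup S] (y x : S) : Prop :=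
  ∃ u : WithOne S, (x : WithOne S) = y * u

/-- `y` is a suffix of `x`, that is `x ∈ S¹ y`. -/
def IsSuffixOf {S : Type u} [Semigroup S] (y x : S) : Prop :=
  ∃ u : WithOne S, (x : WithOne S) = u * y

/-- `y` is a factor of `x`, that is `x ∈ S¹ y S¹`. -/
def IsFactorOf {S : Type u} [Semigroup S] (y x : S) : Prop :=
  ∃ u v : WithOne S, (x : WithOne S) = u * y * v

/-- The letter `c` regarded as an element of the free profinite semigroup. -/
def letter {A : Type u} (c : A) : ProSemi A := word (FreeSemigroup.of c)

/-- `ba` is a connection for `φ`: it is a block of the subshift, `φ^ω(a)` starts with `a`, and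
`φ^ω(b)` ends with `b`. -/
def IsConnection {A : Type u} (φ : FreeSemigroup A →ₙ* FreeSemigroup A) (b a : A) : Prop :=
  [b, a] ∈ language φ ∧ IsPrefixOf (letter a) (subOmega φ (letter a)) ∧
    IsSuffixOf (letter b) (subOmega φ (letter b))

/-- The maximal subgroup `G(φ)` determined by the connection `ba`: the intersection of the
`R`-class of `φ^ω(a)` and the `L`-class of `φ^ω(b)` in the free profinite semigroup. -/
def schutzenbergerGroup {A : Type u} (φ : FreeSemigroup A →ₙ* FreeSemigroup A) (b a : A) :
    Set (ProSemi A) :=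
  {x | (IsPrefixOf (subOmega φ (letter a)) x ∧ IsPrefixOf x (subOmega φ (letter a))) ∧
    (IsSuffixOf (subOmega φ (letter b)) x ∧ IsSuffixOf x (subOmega φ (letter b)))}

/-- The letters that occur in some `φ^ω(c)`. -/
def persistent {A : Type u} (φ : FreeSemigroup A →ₙ* FreeSemigroup A) : Set A :=
  {d | ∃ c, IsFactorOf (letter d) (subOmega φ (letter c))}

/-- The free profinite group on `B ⊆ A` as a closed subgroup of the free profinite group on `A`. -/
def subGrp {A : Type u} (B : Set A) : Set (ProGrp A) :=
  Set.range (gextend (FreeGroup.map (Subtype.val : B → A)))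

/-- `φ` is ultimately group invertible: with `B` the set of the letters occurring in the words
`φ^ω(c)`, the endomorphism of the free profinite group on `A` induced by `φ` restricts to an
automorphism of the free profinite group on `B`. -/
def IsUltimatelyGroupInvertible {A : Type u} (φ : FreeSemigroup A →ₙ* FreeSemigroup A) : Prop :=
  Set.BijOn (groupEndo fun c => φ (FreeSemigroup.of c)) (subGrp (persistent φ))
    (subGrp (persistent φ))

/-- `φᵐ` with `m ≥ 1` is such that `φᵐ(a)` starts with `a` and `φᵐ(b)` ends with `b`. -/
def FixesConnection {A : Type u} (φ : FreeSemigroup A →ₙ* FreeSemigroup A) (b a : A) (m : ℕ) :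
    Prop :=
  0 < m ∧ [a] <+: letters (φ^[m] (FreeSemigroup.of a)) ∧
    [b] <:+ letters (φ^[m] (FreeSemigroup.of b))

/-! ### Presentations of profinite groups -/

/-- The closed normal subgroup generated by a set of relators. -/
def relSubgroup {X : Type u} (R : Set (ProGrp X)) : Subgroup (ProGrp X) :=
  (Subgroup.normalClosure R).topologicalClosure

instance {X : Type u} (R : Set (ProGrp X)) : (relSubgroup R).Normal :=
  Subgroup.is_normal_topologicalClosure _

/-- The subset `H` of the topological semigroup `S` is a group under the multiplication of `S`, with
profinite presentation `⟨X ∣ R⟩` in which each generator `x` stands for `γ x`: the quotient of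
the free profinite group on `X` by the closed normal subgroup generated by `R` is isomorphic to `H`,
algebraically and topologically, by a map that sends the class of `x` to `γ x`. -/
def HasPresentation {X S : Type u} [Semigroup S] [TopologicalSpace S] (R : Set (ProGrp X))
    (H : Set S) (γ : X → S) : Prop :=
  ∃ e : (ProGrp X ⧸ relSubgroup R) ≃ₜ H,
    (∀ p q, (e (p * q) : S) = e p * e q) ∧
    ∀ x, (e (QuotientGroup.mk (gword (FreeGroup.of x))) : S) = γ x

/-- The relators `Φ^ω(x) x⁻¹`, for `x ∈ X`. -/
def omegaRelators {X : Type u} (Φ : ProGrp X →ₜ* ProGrp X) : Set (ProGrp X) :=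
  Set.range fun x : X =>
    omega Φ (gword (FreeGroup.of x)) * (gword (FreeGroup.of x))⁻¹

end Subst

end

namespace Subst

/-! ### Words as lists -/

section Words

variable {A B : Type u}

/-! Let α = φ^ω(a), β = φ^ω(b), and let G (`core α β`) be the set of the elements of αS ∩ Sβ that
are factors of α, S being the free profinite semigroup. Weak primitivity makes the φ^ω-image of
every word of L a factor of each φ^ω(c); in particular βα is a factor of α. With the stability of
compact semigroups, this makes G a group and identifies it with G(φ) (`IsUniform.isLinked`,
`IsLinked.mem_core_iff`). Elements of G are limits of words axb with b·axb·a in L. Such words are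
products of elements of X, so G lies in the closure of X⁺ (`IsUniform.core_subset_closure`).

Group invertibility serves to show that φ^ω fixes G pointwise, for which it suffices that G lies in
the image of every φ^k (`IsUniform.exists_eq_extend_iter`). An element of G is a limit of words
φ^{mj}(a)·x·φ^{mj}(b) that occur in some φ^N(a). Both end blocks and the ambient word are images
under φ^k; if these desubstitutions share a cut inside each end block, the whole word is an image.
Common cuts exist (`exists_common_cut`): a gap t that recurs at two places gives φ^k(w)t = tφ^k(v).
As φ^k is an automorphism of the free group on B, t = φ^k(τ) with wτ = τv, and if τ is short
compared with w, then τ or τ⁻¹ is a positive word; both cases yield a common cut. The descent from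
profinite to discrete free groups is M. Hall's separability theorem (`exists_perm_separating`).

For the presentation, take the closed relation `graph` generated by the pairs (x, x), x ∈ X, between
S and the free profinite group on X. An automaton that cuts words at b.a shows that it is
single-valued (`graph_unique`), so it defines a continuous homomorphism γ from G to the free
profinite group. With Φ the endomorphism induced by φ^m, the relation is invariant under (φ^ω, Φ^ω),
so γ(φ^ω(x)) = Φ^ω(x), which is x modulo the relators: γ is onto modulo the relators. It is also
injective modulo the relators: φ^ω, seen in a finite quotient of A⁺, is controlled by a finite
quotient of the free group on X (`IsUniform.exists_gcoord_iff`), which kills the relators because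
φ^ω is idempotent; and g = φ^ω(g) on G. -/

theorem letters_of (c : A) : letters (FreeSemigroup.of c) = [c] := rfl

theorem letters_mul (v w : FreeSemigroup A) : letters (v * w) = letters v ++ letters w := rfl

theorem letters_ne_nil (w : FreeSemigroup A) : letters w ≠ [] := List.cons_ne_nil _ _

theorem length_letters (w : FreeSemigroup A) : (letters w).length = w.length := rfl

theorem length_letters_pos (w : FreeSemigroup A) : 0 < (letters w).length := Nat.succ_pos _

theorem letters_injective : Function.Injective (letters (A := A)) := by
  rintro ⟨a, l⟩ ⟨b, m⟩ h
  obtain ⟨rfl, rfl⟩ := List.cons.inj h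
  rfl

theorem exists_letters_eq {l : List A} (h : l ≠ []) : ∃ w : FreeSemigroup A, letters w = l := by
  cases l with
  | nil => exact absurd rfl h
  | cons c l => exact ⟨⟨c, l⟩, rfl⟩

theorem letters_map (f : FreeSemigroup A →ₙ* FreeSemigroup B) (w : FreeSemigroup A) :
    letters (f w) = (letters w).flatMap fun c => letters (f (FreeSemigroup.of c)) := by
  induction w using FreeSemigroup.recOnMul with
  | ih1 c => simp [letters_of]
  | ih2 c w h1 h2 => rw [map_mul, letters_mul, letters_mul, List.flatMap_append, h1, h2]

/-- Two factorizations of the same word are comparable. -/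
theorem mul_eq_mul_cases {u v x y : FreeSemigroup A} (h : u * v = x * y) :
    (u = x ∧ v = y) ∨ (∃ s, x = u * s ∧ v = s * y) ∨ ∃ s, u = x * s ∧ y = s * v := by
  have h' := congrArg letters h
  rw [letters_mul, letters_mul, List.append_eq_append_iff] at h'
  rcases h' with ⟨s, h1, h2⟩ | ⟨s, h1, h2⟩
  · by_cases hs : s = []
    · subst hs
      exact Or.inl ⟨letters_injective (by simpa using h1.symm),
        letters_injective (by simpa using h2)⟩
    · obtain ⟨s, rfl⟩ := exists_letters_eq hs
      exact Or.inr (Or.inl ⟨s, letters_injective h1, letters_injective h2⟩)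
  · by_cases hs : s = []
    · subst hs
      exact Or.inl ⟨letters_injective (by simpa using h1),
        letters_injective (by simpa using h2.symm)⟩
    · obtain ⟨s, rfl⟩ := exists_letters_eq hs
      exact Or.inr (Or.inr ⟨s, letters_injective h1, letters_injective h2⟩)

/-- The iterates of a substitution, as homomorphisms. -/
def iter (φ : FreeSemigroup A →ₙ* FreeSemigroup A) (k : ℕ) :
    FreeSemigroup A →ₙ* FreeSemigroup A where
  toFun := φ^[k]
  map_mul' := iterate_map_mul φ k

theorem iter_apply (φ : FreeSemigroup A →ₙ* FreeSemigroup A) (k : ℕ) (w : FreeSemigroup A) :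
    iter φ k w = φ^[k] w := rfl

theorem iter_add_apply (φ : FreeSemigroup A →ₙ* FreeSemigroup A) (j k : ℕ) (w : FreeSemigroup A) :
    iter φ (j + k) w = iter φ j (iter φ k w) := Function.iterate_add_apply φ j k w

theorem length_pos (w : FreeSemigroup A) : 0 < w.length := Nat.succ_pos _

end Words

/-! ### Positive words in free groups -/

section Positive

variable {A : Type u}

/-- The element of the free group represented by a list of generators. -/
def posWord (l : List A) : FreeGroup A := FreeGroup.mk (l.map fun c => (c, true))

theorem posWord_nil : posWord ([] : List A) = 1 := rfl

theorem posWord_append (l m : List A) : posWord (l ++ m) = posWord l * posWord m := by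
  rw [posWord, List.map_append, ← FreeGroup.mul_mk]; rfl

theorem posWord_cons (c : A) (l : List A) : posWord (c :: l) = FreeGroup.of c * posWord l :=
  posWord_append [c] l

theorem isReduced_pos (l : List A) : FreeGroup.IsReduced (l.map fun c => (c, true)) := by
  induction l with
  | nil => exact FreeGroup.IsReduced.nil
  | cons c l ih =>
    cases l with
    | nil => exact FreeGroup.IsReduced.singleton
    | cons d l => exact List.isChain_cons_cons.mpr ⟨fun _ => rfl, ih⟩

theorem toWord_posWord [DecidableEq A] (l : List A) :
    (posWord l).toWord = l.map fun c => (c, true) := by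
  rw [posWord, FreeGroup.toWord_mk, (isReduced_pos l).reduce_eq]

theorem posWord_injective : Function.Injective (posWord (A := A)) := by
  classical
  intro l m h
  have := congrArg FreeGroup.toWord h
  rw [toWord_posWord, toWord_posWord] at this
  exact List.map_injective_iff.mpr (fun _ _ h => congrArg Prod.fst h) this

theorem eq_nil_of_posWord_mul_eq_one {l m : List A} (h : posWord l * posWord m = 1) : l = [] := by
  rw [← posWord_append, ← posWord_nil] at h
  exact (List.append_eq_nil_iff.mp (posWord_injective h)).1

/-- The exponent sum is a homomorphism to an abelian group, hence invariant under conjugation. -/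
theorem length_eq_of_conj {u v : List A} {τ : FreeGroup A}
    (h : posWord u * τ = τ * posWord v) : u.length = v.length := by
  let deg : FreeGroup A →* Multiplicative ℤ := FreeGroup.lift fun _ => Multiplicative.ofAdd 1
  have hdeg : ∀ l : List A, deg (posWord l) = Multiplicative.ofAdd (l.length : ℤ) := by
    intro l
    induction l with
    | nil => rfl
    | cons c l ih =>
      rw [posWord_cons, map_mul, ih, FreeGroup.lift_apply_of, ← ofAdd_add, List.length_cons]
      push_cast
      rw [add_comm]
  have h1 := congrArg deg h
  rw [map_mul, map_mul, mul_comm, hdeg, hdeg] at h1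
  exact_mod_cast Multiplicative.ofAdd.injective (mul_left_cancel h1)

/-- The reduced word of a product is a sublist of the concatenation, so additivity of the norm
leaves no room for cancellation. -/
theorem toWord_eq_append_of_norm [DecidableEq A] {x y : FreeGroup A}
    (h : (x * y).norm = x.norm + y.norm) : (x * y).toWord = x.toWord ++ y.toWord :=
  (FreeGroup.toWord_mul_sublist x y).eq_of_length (by rw [List.length_append]; exact h)

theorem norm_posWord [DecidableEq A] (l : List A) : (posWord l).norm = l.length := by
  rw [FreeGroup.norm, toWord_posWord, List.length_map]

/-- If an element conjugates a positive word to another one, and does not begin with an inverse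
generator, then it is a prefix of the first word, provided that it is not too long. -/
theorem prefix_of_conj_of_head [DecidableEq A] {u v : List A} {τ : FreeGroup A}
    (h : posWord u * τ = τ * posWord v) (hl : τ.norm ≤ u.length)
    (hh : ∀ x ∈ τ.toWord.head?, x.2 = true) : ∃ z, τ = posWord z ∧ z <+: u := by
  have hred : FreeGroup.IsReduced ((posWord u).toWord ++ τ.toWord) := by
    refine List.IsChain.append FreeGroup.isReduced_toWord FreeGroup.isReduced_toWord ?_
    intro x hx y hy _
    rw [hh y hy]
    have := List.mem_of_mem_getLast? hx
    rw [toWord_posWord, List.mem_map] at this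
    obtain ⟨c, _, rfl⟩ := this
    rfl
  have h1 : (posWord u * τ).toWord = (posWord u).toWord ++ τ.toWord := by
    rw [FreeGroup.toWord_mul, hred.reduce_eq]
  -- There is no cancellation in uτ, and u, v have equal length, so the norm of τv = uτ rules out
  -- cancellation in τv as well. Hence τ and u are both prefixes of one reduced word.
  have h2 : (τ * posWord v).toWord = τ.toWord ++ (posWord v).toWord := by
    apply toWord_eq_append_of_norm
    rw [← h, norm_posWord, ← length_eq_of_conj h, FreeGroup.norm, h1, List.length_append,
      toWord_posWord, List.length_map, add_comm]
    rfl
  have h3 : τ.toWord <+: (posWord u).toWord := by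
    refine List.prefix_of_prefix_length_le (l₃ := (posWord u).toWord ++ τ.toWord) ?_
      (List.prefix_append _ _) (by rw [toWord_posWord, List.length_map]; exact hl)
    rw [← h1, h, h2]
    exact List.prefix_append _ _
  rw [toWord_posWord] at h3
  have h4 := List.prefix_iff_eq_take.mp h3
  rw [← List.map_take] at h4
  refine ⟨u.take τ.toWord.length, ?_, List.take_prefix _ _⟩
  rw [posWord, ← h4, FreeGroup.mk_toWord]

/-- A short element that conjugates a positive word to another one is a positive word that is
a prefix of the first, or the inverse of a positive word. -/
theorem prefix_or_inv_of_conj [DecidableEq A] {u v : List A} {τ : FreeGroup A}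
    (h : posWord u * τ = τ * posWord v) (hl : τ.norm ≤ u.length) :
    (∃ z, τ = posWord z ∧ z <+: u) ∨ ∃ z, τ⁻¹ = posWord z := by
  by_cases hh : ∀ x ∈ τ.toWord.head?, x.2 = true
  · exact Or.inl (prefix_of_conj_of_head h hl hh)
  -- Inversion exchanges u and v and turns the last letter of τ into the first letter of τ⁻¹.
  have h' : posWord v * τ⁻¹ = τ⁻¹ * posWord u := by
    rw [eq_inv_mul_iff_mul_eq, ← mul_assoc, ← h, mul_inv_cancel_right]
  have hlen := length_eq_of_conj h
  by_cases ht : ∀ x ∈ τ.toWord.getLast?, x.2 = false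
  · right
    obtain ⟨z, hz, _⟩ := prefix_of_conj_of_head h' (by rw [FreeGroup.norm_inv_eq]; omega) (by
      intro x hx
      rw [FreeGroup.toWord_inv, FreeGroup.invRev, List.head?_reverse, List.getLast?_map] at hx
      obtain ⟨y, hy, rfl⟩ := Option.mem_map.mp hx
      simp [ht y hy])
    exact ⟨z, hz⟩
  -- Remaining case: τ starts with an inverse generator and ends with a generator. Then τv is
  -- reduced, by length so is uτ, and comparing first letters sets a generator against an inverse
  -- generator.
  exfalso
  push Not at hh ht
  obtain ⟨x, hx, hx'⟩ := hh
  obtain ⟨y, hy, hy'⟩ := ht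
  have hy' : y.2 = true := by simpa using hy'
  have hred : FreeGroup.IsReduced (τ.toWord ++ (posWord v).toWord) := by
    refine List.IsChain.append FreeGroup.isReduced_toWord FreeGroup.isReduced_toWord ?_
    intro y₁ hy₁ z hz _
    have := List.mem_of_mem_head? hz
    rw [toWord_posWord, List.mem_map] at this
    obtain ⟨c, _, rfl⟩ := this
    rw [Option.mem_unique hy₁ hy, hy']
  have h1 : (τ * posWord v).toWord = τ.toWord ++ (posWord v).toWord := by
    rw [FreeGroup.toWord_mul, hred.reduce_eq]
  have h2 : (posWord u * τ).toWord = (posWord u).toWord ++ τ.toWord := by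
    apply toWord_eq_append_of_norm
    rw [h, norm_posWord, hlen, FreeGroup.norm, h1, List.length_append,
      toWord_posWord, List.length_map, add_comm]
    rfl
  have h3 : (posWord u).toWord ++ τ.toWord = τ.toWord ++ (posWord v).toWord := by
    rw [← h1, ← h2, h]
  obtain ⟨l, hl'⟩ : ∃ l, τ.toWord = x :: l := by
    cases hw : τ.toWord with
    | nil => rw [hw] at hx; simp at hx
    | cons z l => rw [hw] at hx; exact ⟨l, by simpa using hx⟩
  cases u with
  | nil =>
    have : τ.toWord.length ≤ 0 := hl
    rw [hl'] at this
    simp at this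
  | cons c u =>
    rw [toWord_posWord, hl', List.map_cons, List.cons_append, List.cons_append] at h3
    exact hx' (congrArg Prod.snd (List.cons.inj h3).1).symm

end Positive

/-! ### Recognizability -/

section Recognizability

variable {A : Type u}

/-- The endomorphism of the free group induced by a map from letters to words. -/
def grpHom (σ : A → List A) : FreeGroup A →* FreeGroup A := FreeGroup.lift fun c => posWord (σ c)

theorem grpHom_posWord (σ : A → List A) (l : List A) :
    grpHom σ (posWord l) = posWord (l.flatMap σ) := by
  induction l with
  | nil => rfl
  | cons c l ih =>
    rw [posWord_cons, map_mul, ih, List.flatMap_cons, posWord_append, grpHom,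
      FreeGroup.lift_apply_of]

/-- The subgroup of the free group generated by a set of letters. -/
def letterSubgroup (B : Set A) : Subgroup (FreeGroup A) := Subgroup.closure (FreeGroup.of '' B)

theorem posWord_mem {B : Set A} {l : List A} (h : ∀ c ∈ l, c ∈ B) :
    posWord l ∈ letterSubgroup B := by
  induction l with
  | nil => exact one_mem _
  | cons c l ih =>
    rw [posWord_cons]
    exact mul_mem (Subgroup.subset_closure ⟨c, h c (by simp), rfl⟩)
      (ih fun d hd => h d (by simp [hd]))

/-- Past every position there is a cut within bounded distance. -/
theorem exists_cut {σ : A → List A} {ℓ : ℕ} (hσ : ∀ c, (σ c).length ≤ ℓ) (v : List A) {n : ℕ}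
    (hn : n ≤ (v.flatMap σ).length) :
    ∃ v₁, v₁ <+: v ∧ n ≤ (v₁.flatMap σ).length ∧ (v₁.flatMap σ).length ≤ n + ℓ := by
  induction v using List.reverseRecOn with
  | nil => exact ⟨[], List.prefix_rfl, hn, by simp⟩
  | append_singleton v c ih =>
    by_cases h : n ≤ (v.flatMap σ).length
    · obtain ⟨v₁, h1, h2⟩ := ih h
      exact ⟨v₁, h1.trans (List.prefix_append _ _), h2⟩
    · refine ⟨_, List.prefix_rfl, hn, ?_⟩
      have := hσ c
      simp only [List.length_append, List.flatMap_append, List.flatMap_singleton] at h ⊢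
      omega

theorem length_flatMap_prefix_le {σ : A → List A} {u v : List A} (h : u <+: v) :
    (u.flatMap σ).length ≤ (v.flatMap σ).length := by
  obtain ⟨w, rfl⟩ := h
  simp

theorem prefix_of_length_flatMap_lt {σ : A → List A} {u v w : List A} (hu : u <+: w) (hv : v <+: w)
    (h : (u.flatMap σ).length < (v.flatMap σ).length) : u <+: v := by
  rcases List.prefix_or_prefix_of_prefix hu hv with h1 | h1
  · exact h1
  · exact absurd (length_flatMap_prefix_le (σ := σ) h1) (by omega)

theorem length_le_flatMap {σ : A → List A} (hσ : ∀ c, σ c ≠ []) (u : List A) :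
    u.length ≤ (u.flatMap σ).length := by
  induction u with
  | nil => simp
  | cons c u ih =>
    have := List.length_pos_iff.mpr (hσ c)
    simp only [List.flatMap_cons, List.length_append, List.length_cons]
    omega

/-- If `σ` induces an automorphism of the free group on `B`, then two desubstitutions of the same
word have a common cut within each long enough stretch. -/
theorem exists_common_cut [Finite A] {σ : A → List A} {B : Set A} (hne : ∀ c, σ c ≠ [])
    (hsurj : ∀ t ∈ letterSubgroup B, ∃ τ ∈ letterSubgroup B, grpHom σ τ = t)
    (hinj : ∀ τ ∈ letterSubgroup B, ∀ τ' ∈ letterSubgroup B, grpHom σ τ = grpHom σ τ' → τ = τ')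
    {ℓ : ℕ} (hℓ : ∀ c, (σ c).length ≤ ℓ) :
    ∃ C : ℕ, ∀ r u r' v : List A, (∀ c ∈ u, c ∈ B) → (∀ c ∈ v, c ∈ B) →
      (∀ c ∈ v.flatMap σ, c ∈ B) → C ≤ u.length → r ++ u.flatMap σ ++ r' = v.flatMap σ →
      ∃ u₁ v₁, u₁ <+: u ∧ v₁ <+: v ∧ r ++ u₁.flatMap σ = v₁.flatMap σ := by
  classical
  -- The possible gaps from a position to the next cut of the other factorization.
  let T := {t : List A // t.length ≤ ℓ}
  have : Finite T := (List.finite_length_le A ℓ).to_subtype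
  have : Fintype T := Fintype.ofFinite T
  have hθ : ∀ t : T, ∃ τ : FreeGroup A, (∀ c ∈ t.1, c ∈ B) →
      τ ∈ letterSubgroup B ∧ grpHom σ τ = posWord t.1 := by
    intro t
    by_cases h : ∀ c ∈ t.1, c ∈ B
    · obtain ⟨τ, h1, h2⟩ := hsurj _ (posWord_mem h)
      exact ⟨τ, fun _ => ⟨h1, h2⟩⟩
    · exact ⟨1, fun h' => absurd h' h⟩
  choose θ hθ using hθ
  -- Positions at distance `D` enclose a word at least as long as every `θ t`; the `+ 1` keeps
  -- distinct positions apart.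
  let D := Finset.univ.sup (fun t => (θ t).norm) + 1
  have hD : ∀ t, (θ t).norm ≤ D := fun t =>
    (Finset.le_sup (f := fun t => (θ t).norm) (Finset.mem_univ t)).trans (Nat.le_succ _)
  refine ⟨Fintype.card T * D, fun r u r' v hu hv hvσ hul heq => ?_⟩
  -- the cut following each position `j * D`
  have hcut : ∀ j : Fin (Fintype.card T + 1), ∃ (v₁ : List A) (t : T), v₁ <+: v ∧
      r ++ (u.take (j * D)).flatMap σ ++ t.1 = v₁.flatMap σ := by
    intro j
    have hj : (j : ℕ) * D ≤ Fintype.card T * D := Nat.mul_le_mul_right _ (Nat.le_of_lt_succ j.2)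
    have hpos : (r ++ (u.take (j * D)).flatMap σ).length ≤ (v.flatMap σ).length := by
      have h1 := congrArg List.length heq
      have h2 : u.flatMap σ = (u.take (j * D)).flatMap σ ++ (u.drop (j * D)).flatMap σ := by
        rw [← List.flatMap_append, List.take_append_drop]
      have h3 := length_le_flatMap hne (u.drop (j * D))
      rw [h2] at h1
      simp only [List.length_append, List.length_drop] at h1 h3 ⊢
      omega
    obtain ⟨v₁, h1, h2, h3⟩ := exists_cut hℓ v hpos
    have h4 : r ++ (u.take (j * D)).flatMap σ <+: v₁.flatMap σ := by
      refine List.prefix_of_prefix_length_le (l₃ := r ++ u.flatMap σ ++ r') ?_ ?_ h2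
      · conv_rhs => rw [← List.take_append_drop (j * D) u, List.flatMap_append]
        exact ⟨(u.drop (j * D)).flatMap σ ++ r', by simp only [List.append_assoc]⟩
      · rw [heq]
        obtain ⟨v₂, rfl⟩ := h1
        exact ⟨v₂.flatMap σ, List.flatMap_append.symm⟩
    obtain ⟨t, ht⟩ := h4
    refine ⟨v₁, ⟨t, ?_⟩, h1, ht⟩
    rw [← ht, List.length_append (bs := t)] at h3
    omega
  choose V t hV ht using hcut
  -- There are `card T + 1` positions, so some gap occurs twice.
  obtain ⟨i, j, hij, htij⟩ := Fintype.exists_ne_map_eq_of_card_lt t (by simp)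
  wlog hlt : i < j generalizing i j
  · exact this j i hij.symm htij.symm (lt_of_le_of_ne (not_lt.mp hlt) hij.symm)
  have hlt' : (i : ℕ) + 1 ≤ j := hlt
  -- the stretch of `u` between the two positions
  obtain ⟨w, hw⟩ : u.take (i * D) <+: u.take (j * D) :=
    List.take_prefix_take_left (Nat.mul_le_mul_right _ (by omega))
  have hwu : u.take (i * D) ++ w <+: u := hw ▸ List.take_prefix _ _
  have hjD : (j : ℕ) * D ≤ Fintype.card T * D := Nat.mul_le_mul_right _ (Nat.le_of_lt_succ j.2)
  have hwl : D ≤ w.length := by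
    have h1 := congrArg List.length hw
    have h2 : (i : ℕ) * D + D ≤ j * D := by
      have := Nat.mul_le_mul_right D hlt'
      rwa [Nat.succ_mul] at this
    rw [List.length_append, List.length_take, List.length_take] at h1
    omega
  have hi := ht i
  have hj := ht j
  rw [← hw, ← htij] at hj
  have hVV : V i <+: V j := by
    refine prefix_of_length_flatMap_lt (σ := σ) (hV i) (hV j) ?_
    have h1 := congrArg List.length hi
    have h2 := congrArg List.length hj
    have h3 := length_le_flatMap hne w
    have h4 : 1 ≤ D := Nat.succ_pos _
    simp only [List.length_append, List.flatMap_append] at h1 h2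
    omega
  obtain ⟨v', hv'⟩ := hVV
  have hword : w.flatMap σ ++ (t i).1 = (t i).1 ++ v'.flatMap σ := by
    have h5 : (V j).flatMap σ =
        r ++ (u.take (i * D)).flatMap σ ++ (t i).1 ++ v'.flatMap σ := by
      rw [← hv', List.flatMap_append, ← hi]
    rw [h5, List.flatMap_append] at hj
    simpa only [List.append_assoc, List.append_cancel_left_eq] using hj
  have hwB : ∀ c ∈ w, c ∈ B := fun c hc =>
    hu c (hwu.subset (List.mem_append_right _ hc))
  have hv'B : ∀ c ∈ v', c ∈ B := fun c hc =>
    hv c ((hV j).subset (hv' ▸ List.mem_append_right _ hc))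
  have htB : ∀ c ∈ (t i).1, c ∈ B := by
    intro c hc
    obtain ⟨v₂, hv₂⟩ := hV i
    refine hvσ c ?_
    rw [← hv₂, List.flatMap_append, ← hi]
    simp [hc]
  obtain ⟨hτ, hτt⟩ := hθ (t i) htB
  -- The identity σ(w)t = tσ(v') of words is pulled back through the automorphism of the free group.
  have hconj : posWord w * θ (t i) = θ (t i) * posWord v' := by
    refine hinj _ (mul_mem (posWord_mem hwB) hτ) _ (mul_mem hτ (posWord_mem hv'B)) ?_
    rw [map_mul, map_mul, hτt, grpHom_posWord, grpHom_posWord, ← posWord_append, ← posWord_append,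
      hword]
  -- If τ is a positive prefix z of `w`, the gap is σ(z), and advancing by z in `u` reaches the cut.
  -- If τ⁻¹ is positive, the gap times a positive word is 1, so the gap is empty.
  rcases prefix_or_inv_of_conj hconj ((hD _).trans hwl) with ⟨z, hz, hzw⟩ | ⟨z, hz⟩
  · have htz : (t i).1 = z.flatMap σ := posWord_injective (by
      rw [← hτt, hz, grpHom_posWord])
    refine ⟨u.take (i * D) ++ z, V i, ?_, hV i, ?_⟩
    · exact ((List.prefix_append_right_inj _).mpr hzw).trans hwu
    · rw [List.flatMap_append, ← htz, ← List.append_assoc, hi]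
  · have htn : (t i).1 = [] := by
      refine eq_nil_of_posWord_mul_eq_one (m := z.flatMap σ) ?_
      rw [← hτt, ← grpHom_posWord, ← map_mul, ← hz, mul_inv_cancel, map_one]
    rw [htn, List.append_nil] at hi
    exact ⟨_, V i, List.take_prefix _ _, hV i, hi⟩

end Recognizability

/-! ### Separability of finitely generated subgroups of free groups -/

section Hall

variable {A : Type u}

/-- A finitely generated subgroup `M` of a free group is the stabilizer, up to a given element
outside of `M`, of a point in a finite permutation representation. -/
theorem exists_perm_separating (R : Set (FreeGroup A)) (hR : R.Finite) {d : FreeGroup A}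
    (hd : d ∉ Subgroup.closure R) :
    ∃ (V : Type u) (_ : Finite V) (ρ : FreeGroup A →* Equiv.Perm V) (v₀ : V),
      (∀ g ∈ Subgroup.closure R, ρ g v₀ = v₀) ∧ ρ d v₀ ≠ v₀ := by
  classical
  let M := Subgroup.closure R
  let pt : List (A × Bool) → FreeGroup A ⧸ M := fun l => (FreeGroup.mk l : FreeGroup A)
  -- Suffixes of the reduced words of `d` and of the generators: their cosets are the vertices of
  -- the Schreier graph met by the paths of these words from the base point.
  let W : Set (List (A × Bool)) := {l | ∃ g ∈ insert d R, l <:+ g.toWord}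
  have hW : W.Finite := by
    have : W = ⋃ g ∈ insert d R, {l | l ∈ g.toWord.tails} := by
      ext l; simp [W, List.mem_tails]
    rw [this]
    exact (hR.insert d).biUnion fun g _ => List.finite_toSet _
  let V : Set (FreeGroup A ⧸ M) := pt '' W
  have hV : Finite V := (hW.image pt).to_subtype
  have : Fintype V := Fintype.ofFinite V
  have hnil : ([] : List (A × Bool)) ∈ W := ⟨d, Set.mem_insert _ _, List.nil_suffix⟩
  have hperm : ∀ x : A, ∃ π : Equiv.Perm V, ∀ v w : V,
      (w : FreeGroup A ⧸ M) = FreeGroup.of x • (v : FreeGroup A ⧸ M) → π v = w := by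
    intro x
    -- A generator acts on `V` as a partial injection, which on a finite set extends to a
    -- permutation.
    let e : {v : V // FreeGroup.of x • (v : FreeGroup A ⧸ M) ∈ V} ≃
        {v : V // (FreeGroup.of x)⁻¹ • (v : FreeGroup A ⧸ M) ∈ V} :=
      { toFun := fun v => ⟨⟨_, v.2⟩, by rw [inv_smul_smul]; exact v.1.2⟩
        invFun := fun v => ⟨⟨_, v.2⟩, by rw [smul_inv_smul]; exact v.1.2⟩
        left_inv := fun v => by ext; simp
        right_inv := fun v => by ext; simp }
    refine ⟨e.extendSubtype, fun v w h => ?_⟩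
    rw [e.extendSubtype_apply_of_mem v (by rw [← h]; exact w.2)]
    exact Subtype.ext h.symm
  choose π hπ using hperm
  let ρ : FreeGroup A →* Equiv.Perm V := FreeGroup.lift π
  let v₀ : V := ⟨pt [], [], hnil, rfl⟩
  have hcons : ∀ (x : A) (ε : Bool) (l : List (A × Bool)),
      (FreeGroup.mk ((x, ε) :: l) : FreeGroup A) = FreeGroup.mk [(x, ε)] * FreeGroup.mk l :=
    fun x ε l => by rw [FreeGroup.mul_mk]; rfl
  have key : ∀ (l : List (A × Bool)) (hl : l ∈ W), ρ (FreeGroup.mk l) v₀ = ⟨pt l, l, hl, rfl⟩ := by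
    intro l
    induction l with
    | nil => intro _; rfl
    | cons y l ih =>
      intro hl
      obtain ⟨x, ε⟩ := y
      have hl' : l ∈ W := by
        obtain ⟨g, hg, h⟩ := hl
        exact ⟨g, hg, (List.suffix_cons _ _).trans h⟩
      rw [hcons, map_mul, Equiv.Perm.mul_apply, ih hl']
      cases ε with
      | true =>
        have : ρ (FreeGroup.mk [(x, true)]) = π x := FreeGroup.lift_apply_of
        rw [this]
        apply hπ
        change pt ((x, true) :: l) = _
        simp only [pt]
        rw [hcons]
        rfl
      | false =>
        have : ρ (FreeGroup.mk [(x, false)]) = (π x)⁻¹ := by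
          have h1 : (FreeGroup.mk [(x, false)] : FreeGroup A) = (FreeGroup.of x)⁻¹ := rfl
          rw [h1, map_inv]
          exact congrArg _ FreeGroup.lift_apply_of
        rw [this, Equiv.Perm.inv_eq_iff_eq]
        symm
        apply hπ
        change pt l = FreeGroup.of x • pt ((x, false) :: l)
        have h1 : pt ((x, false) :: l) = (FreeGroup.of x)⁻¹ • pt l := by
          simp only [pt]
          rw [hcons]
          rfl
        rw [h1, smul_inv_smul]
  have key' : ∀ g ∈ insert d R, (ρ g v₀ : V).1 = (g : FreeGroup A ⧸ M) := by
    intro g hg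
    have := key g.toWord ⟨g, hg, List.suffix_rfl⟩
    rw [FreeGroup.mk_toWord] at this
    rw [this]
    simp only [pt, FreeGroup.mk_toWord]
  refine ⟨V, hV, ρ, v₀, fun g hg => ?_, fun h => hd ?_⟩
  · have : Subgroup.closure R ≤ (MulAction.stabilizer (Equiv.Perm V) v₀).comap ρ := by
      rw [Subgroup.closure_le]
      intro g hg
      change ρ g v₀ = v₀
      apply Subtype.ext
      rw [key' g (Set.mem_insert_of_mem _ hg)]
      refine QuotientGroup.eq.mpr ?_
      change g⁻¹ * 1 ∈ Subgroup.closure R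
      rw [mul_one]
      exact inv_mem (Subgroup.subset_closure hg)
    exact this hg
  · have h1 := key' d (Set.mem_insert _ _)
    rw [h] at h1
    have h2 : ((1 : FreeGroup A) : FreeGroup A ⧸ M) = d := h1
    simpa [M] using QuotientGroup.eq.mp h2

/-- The finite-index normal subgroup given by a homomorphism to a finite group. -/
def kerSubgroup {G K : Type*} [Group G] [Group K] [Finite K] (f : G →* K) :
    FiniteIndexNormalSubgroup G where
  toSubgroup := f.ker
  isNormal' := inferInstance
  isFiniteIndex' := Subgroup.finiteIndex_ker f

theorem gword_mul {X : Type u} (g h : FreeGroup X) : gword (g * h) = gword g * gword h := rfl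

/-- The component of an element of the free profinite group in a finite quotient. -/
def gcoord {X : Type u} (N : FiniteIndexNormalSubgroup (FreeGroup X)) :
    ProGrp X →* FreeGroup X ⧸ N.toSubgroup where
  toFun z := z.1 N
  map_one' := rfl
  map_mul' _ _ := rfl

theorem gcoord_gword {X : Type u} (N : FiniteIndexNormalSubgroup (FreeGroup X)) (g : FreeGroup X) :
    gcoord N (gword g) = g := rfl

theorem isOpen_gcoord {X : Type u} (N : FiniteIndexNormalSubgroup (FreeGroup X))
    (q : FreeGroup X ⧸ N.toSubgroup) : IsOpen {z : ProGrp X | gcoord N z = q} := by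
  let iT : TopologicalSpace (FreeGroup X ⧸ N.toSubgroup) := ⊥
  have iD : DiscreteTopology (FreeGroup X ⧸ N.toSubgroup) := ⟨rfl⟩
  have : Continuous fun z : ProGrp X => (z.1 N : FreeGroup X ⧸ N.toSubgroup) :=
    (continuous_apply N).comp continuous_subtype_val
  exact (isOpen_discrete {q}).preimage this

theorem gcoord_ext {X : Type u} {y z : ProGrp X} (h : ∀ N, gcoord N y = gcoord N z) : y = z :=
  Subtype.ext (funext h)

/-- Residual finiteness of free groups, from `exists_perm_separating` for the trivial subgroup. -/
theorem gword_injective {X : Type u} : Function.Injective (gword (X := X)) := by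
  intro g h hgh
  by_contra hne
  have hd : h⁻¹ * g ∉ Subgroup.closure (∅ : Set (FreeGroup X)) := by
    rw [Subgroup.closure_empty, Subgroup.mem_bot, inv_mul_eq_one]
    exact fun h => hne h.symm
  obtain ⟨V, _, ρ, v₀, -, h2⟩ := exists_perm_separating ∅ Set.finite_empty hd
  have h3 := congrArg (gcoord (kerSubgroup ρ)) hgh
  rw [gcoord_gword, gcoord_gword] at h3
  have h4 : h⁻¹ * g ∈ ρ.ker := QuotientGroup.eq.mp h3.symm
  rw [MonoidHom.mem_ker.mp h4] at h2
  exact h2 rfl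

/-- The free group is dense and the coordinate is locally constant, so a finite quotient cannot tell
a profinite argument from a suitable discrete one. -/
theorem gextend_mem_of_dense {X Y : Type u} (f : FreeGroup X →* FreeGroup Y)
    (N : FiniteIndexNormalSubgroup (FreeGroup Y)) (z : ProGrp X) :
    ∃ g : FreeGroup X, gcoord N (gextend f z) = f g := by
  have hopen : IsOpen {y : ProGrp X | gcoord N (gextend f y) = gcoord N (gextend f z)} :=
    (isOpen_gcoord N _).preimage (gextend f).continuous_toFun
  obtain ⟨y, hy, g, rfl⟩ := (ProfiniteGrp.ProfiniteCompletion.denseRange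
    (GrpCat.of (FreeGroup X))).inter_open_nonempty _ hopen ⟨z, rfl⟩
  refine ⟨g, hy.symm.trans ?_⟩
  change gcoord N (gextend f (gword g)) = _
  rw [gextend_gword, gcoord_gword]

theorem letterSubgroup_eq_range (B : Set A) :
    letterSubgroup B = (FreeGroup.map (Subtype.val : B → A)).range := by
  rw [MonoidHom.range_eq_map, ← FreeGroup.closure_range_of, MonoidHom.map_closure, letterSubgroup]
  congr 1
  ext g
  constructor
  · rintro ⟨c, hc, rfl⟩
    exact ⟨FreeGroup.of ⟨c, hc⟩, ⟨_, rfl⟩, FreeGroup.map.of⟩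
  · rintro ⟨_, ⟨c, rfl⟩, rfl⟩
    exact ⟨c, c.2, FreeGroup.map.of.symm⟩

/-- The endomorphism of the free group induced by a substitution. -/
def substHom (φ : FreeSemigroup A →ₙ* FreeSemigroup A) : FreeGroup A →* FreeGroup A :=
  FreeGroup.lift fun c => toGroup (φ (FreeSemigroup.of c))

theorem groupEndo_gword {X : Type u} (w : X → FreeSemigroup X) (g : FreeGroup X) :
    groupEndo w (gword g) = gword (FreeGroup.lift (fun x => toGroup (w x)) g) :=
  gextend_gword _ _

/-- If a substitution restricts to an injective map of the free profinite group on `B`, it does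
so on the free group on `B`. -/
theorem substHom_injOn {φ : FreeSemigroup A →ₙ* FreeSemigroup A} {B : Set A}
    (h : Set.InjOn (groupEndo fun c => φ (FreeSemigroup.of c)) (subGrp B)) :
    Set.InjOn (substHom φ) (letterSubgroup B) := by
  have hmem : ∀ τ ∈ letterSubgroup B, gword τ ∈ subGrp B := by
    intro τ hτ
    rw [letterSubgroup_eq_range] at hτ
    obtain ⟨g, rfl⟩ := hτ
    exact ⟨gword g, gextend_gword _ _⟩
  intro τ hτ τ' hτ' heq
  apply gword_injective
  apply h (hmem τ hτ) (hmem τ' hτ')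
  rw [groupEndo_gword, groupEndo_gword]
  exact congrArg gword heq

/-- If a substitution restricts to a surjective map of the free profinite group on `B`, it does
so on the free group on `B`. -/
theorem substHom_surjOn [Finite A] {φ : FreeSemigroup A →ₙ* FreeSemigroup A} {B : Set A}
    (h : Set.SurjOn (groupEndo fun c => φ (FreeSemigroup.of c)) (subGrp B) (subGrp B)) :
    letterSubgroup B ≤ (letterSubgroup B).map (substHom φ) := by
  have hmap : (letterSubgroup B).map (substHom φ) =
      Subgroup.closure ((fun c => substHom φ (FreeGroup.of c)) '' B) := by
    rw [letterSubgroup, MonoidHom.map_closure, Set.image_image]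
  rw [letterSubgroup, Subgroup.closure_le]
  rintro _ ⟨d, hd, rfl⟩
  by_contra hnot
  rw [SetLike.mem_coe, ← letterSubgroup, hmap] at hnot
  -- A finite action in which the image of the free group on `B` fixes `v₀` but `d` does not. A
  -- profinite preimage of `d`, read modulo `ρ.ker`, gives an element of that image acting like `d`.
  obtain ⟨V, _, ρ, v₀, h1, h2⟩ := exists_perm_separating _ ((Set.toFinite B).image _) hnot
  have hgd : gword (FreeGroup.of d) ∈ subGrp B := by
    refine ⟨gword (FreeGroup.of ⟨d, hd⟩), ?_⟩
    rw [gextend_gword, FreeGroup.map.of]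
  obtain ⟨_, ⟨z, rfl⟩, hz⟩ := h hgd
  have hcomp : ∀ z, groupEndo (fun c => φ (FreeSemigroup.of c))
      (gextend (FreeGroup.map (Subtype.val : B → A)) z) =
      gextend ((substHom φ).comp (FreeGroup.map Subtype.val)) z := by
    intro z
    refine congrFun ((ProfiniteGrp.ProfiniteCompletion.denseRange
      (GrpCat.of (FreeGroup B))).equalizer
      ((groupEndo _).continuous_toFun.comp (gextend _).continuous_toFun)
      (gextend _).continuous_toFun (funext fun g => ?_)) z
    change groupEndo _ (gextend _ (gword g)) = gextend _ (gword g)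
    rw [gextend_gword, gextend_gword, groupEndo_gword]
    rfl
  obtain ⟨g, hg⟩ := gextend_mem_of_dense ((substHom φ).comp (FreeGroup.map (Subtype.val : B → A)))
    (kerSubgroup ρ) z
  rw [← hcomp, hz, gcoord_gword] at hg
  have h4 : (FreeGroup.of d)⁻¹ * substHom φ (FreeGroup.map Subtype.val g) ∈ ρ.ker :=
    QuotientGroup.eq.mp hg
  rw [MonoidHom.mem_ker, map_mul, map_inv, inv_mul_eq_one] at h4
  apply h2
  rw [h4]
  apply h1
  rw [← hmap, letterSubgroup_eq_range]
  exact ⟨_, ⟨g, rfl⟩, rfl⟩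

end Hall

/-! ### The topology of the free profinite semigroup -/

section Topology

variable {A : Type u}

theorem word_coord_eq_iff (c : FinCon A) (v w : FreeSemigroup A) :
    (word v).1 c = (word w).1 c ↔ c.1 v w :=
  Quotient.eq'' (s₁ := c.1.toSetoid)

theorem continuous_coord (c : FinCon A) : Continuous fun x : ProSemi A => x.1 c :=
  (continuous_apply c).comp continuous_subtype_val

theorem coord_mul (x y : ProSemi A) (c : FinCon A) : (x * y).1 c = x.1 c * y.1 c := rfl

theorem isOpen_coord (c : FinCon A) (q : FinQuot c) : IsOpen {x : ProSemi A | x.1 c = q} :=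
  (isOpen_discrete {q}).preimage (continuous_coord c)

theorem exists_word_mem {U : Set (ProSemi A)} (hU : IsOpen U) {x : ProSemi A} (hx : x ∈ U) :
    ∃ w, word w ∈ U := by
  obtain ⟨_, h, w, rfl⟩ := denseRange_word.inter_open_nonempty U hU ⟨x, hx⟩
  exact ⟨w, h⟩

theorem exists_word_coord (c : FinCon A) (x : ProSemi A) : ∃ w, (word w).1 c = x.1 c :=
  exists_word_mem (isOpen_coord c (x.1 c)) rfl

theorem exists_word_coord₂ (c d : FinCon A) (x : ProSemi A) :
    ∃ w, (word w).1 c = x.1 c ∧ (word w).1 d = x.1 d :=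
  exists_word_mem ((isOpen_coord c (x.1 c)).inter (isOpen_coord d (x.1 d))) ⟨rfl, rfl⟩

/-- The components of an element of the free profinite semigroup are compatible. -/
theorem coord_eq_of_le {c d : FinCon A} (h : c.1 ≤ d.1) {x y : ProSemi A} (hxy : x.1 c = y.1 c) :
    x.1 d = y.1 d := by
  obtain ⟨v, hv, hv'⟩ := exists_word_coord₂ c d x
  obtain ⟨w, hw, hw'⟩ := exists_word_coord₂ c d y
  rw [← hv', ← hw', word_coord_eq_iff]
  exact h ((word_coord_eq_iff c v w).mp (by rw [hv, hw, hxy]))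

theorem coord_ext {x y : ProSemi A} (h : ∀ c, x.1 c = y.1 c) : x = y := Subtype.ext (funext h)

/-- The finite-index congruence given by a map with finitely many values. -/
def FinCon.ofMap {T : Type*} [Finite T] (c : Con (FreeSemigroup A)) (f : FreeSemigroup A → T)
    (h : ∀ v w, f v = f w → c v w) : FinCon A :=
  ⟨c, by
    let g : Set.range f → c.Quotient := fun t => (Quotient.mk'' t.2.choose : c.Quotient)
    refine Finite.of_surjective g ?_
    rintro ⟨w⟩
    refine ⟨⟨f w, w, rfl⟩, ?_⟩
    exact Quotient.sound' (h _ _ (Set.mem_range_self (f := f) w).choose_spec)⟩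

/-- The class of a word. -/
def FinCon.cls (c : FinCon A) (w : FreeSemigroup A) : c.1.Quotient := Quotient.mk'' w

theorem FinCon.cls_eq_iff (c : FinCon A) (v w : FreeSemigroup A) :
    c.cls v = c.cls w ↔ c.1 v w := Quotient.eq'' (s₁ := c.1.toSetoid)

/-- The intersection of two finite-index congruences. -/
def FinCon.inf (c d : FinCon A) : FinCon A :=
  have : Finite c.1.Quotient := c.2
  have : Finite d.1.Quotient := d.2
  FinCon.ofMap (T := c.1.Quotient × d.1.Quotient) (c.1 ⊓ d.1) (fun w => (c.cls w, d.cls w))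
    fun _ _ h => ⟨(c.cls_eq_iff _ _).mp (congrArg Prod.fst h),
      (d.cls_eq_iff _ _).mp (congrArg Prod.snd h)⟩

theorem FinCon.inf_le_left (c d : FinCon A) : (c.inf d).1 ≤ c.1 := fun _ _ h => h.1

theorem FinCon.inf_le_right (c d : FinCon A) : (c.inf d).1 ≤ d.1 := fun _ _ h => h.2

/-- The congruence with one class. -/
def FinCon.top (A : Type u) : FinCon A := FinCon.ofMap ⊤ (fun _ => ()) fun _ _ _ => trivial

theorem exists_finCon_le_all (I : Finset (FinCon A)) : ∃ c : FinCon A, ∀ d ∈ I, c.1 ≤ d.1 := by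
  classical
  induction I using Finset.induction_on with
  | empty => exact ⟨FinCon.top A, by simp⟩
  | insert d I _ ih =>
    obtain ⟨c, hc⟩ := ih
    refine ⟨d.inf c, fun e he => ?_⟩
    rcases Finset.mem_insert.mp he with rfl | he
    · exact FinCon.inf_le_left _ _
    · exact (FinCon.inf_le_right d c).trans (hc e he)

/-- The sets of elements with a given component form a basis of neighborhoods. -/
theorem exists_coord_subset {U : Set (ProSemi A)} (hU : IsOpen U) {x : ProSemi A} (hx : x ∈ U) :
    ∃ c : FinCon A, ∀ y : ProSemi A, y.1 c = x.1 c → y ∈ U := by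
  obtain ⟨O, hO, rfl⟩ := hU
  obtain ⟨I, u, h1, h2⟩ := isOpen_pi_iff.mp hO x.1 hx
  obtain ⟨c, hc⟩ := exists_finCon_le_all I
  refine ⟨c, fun y hy => h2 fun d hd => ?_⟩
  rw [coord_eq_of_le (hc d hd) hy]
  exact (h1 d hd).2

/-- Reduces membership in a closed set to one finite quotient at a time, since the coordinates give
a neighborhood basis. -/
theorem mem_of_isClosed_of_coord {T : Set (ProSemi A)} (hT : IsClosed T) {x : ProSemi A}
    (h : ∀ c : FinCon A, ∃ y ∈ T, y.1 c = x.1 c) : x ∈ T := by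
  by_contra hx
  obtain ⟨c, hc⟩ := exists_coord_subset hT.isOpen_compl hx
  obtain ⟨y, hy, hyc⟩ := h c
  exact hc y hyc hy

instance : T2Space (ProSemi A) := inferInstanceAs (T2Space (Subtype _))

/-- The congruence that records, besides the class of a word, the pairs of classes of the factors
in its factorizations. -/
def FinCon.split (c : FinCon A) : FinCon A :=
  have : Finite c.1.Quotient := c.2
  FinCon.ofMap (T := c.1.Quotient × Set (c.1.Quotient × c.1.Quotient))
    { r := fun v w => c.1 v w ∧ ∀ p q, (∃ v₁ v₂, v = v₁ * v₂ ∧ c.1 p v₁ ∧ c.1 q v₂) ↔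
        ∃ w₁ w₂, w = w₁ * w₂ ∧ c.1 p w₁ ∧ c.1 q w₂
      iseqv :=
        { refl := fun v => ⟨c.1.refl v, fun _ _ => Iff.rfl⟩
          symm := fun h => ⟨c.1.symm h.1, fun p q => (h.2 p q).symm⟩
          trans := fun h h' => ⟨c.1.trans h.1 h'.1, fun p q => (h.2 p q).trans (h'.2 p q)⟩ }
      mul' := by
        have key : ∀ {v w x y : FreeSemigroup A},
            (c.1 v w ∧ ∀ p q, (∃ v₁ v₂, v = v₁ * v₂ ∧ c.1 p v₁ ∧ c.1 q v₂) ↔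
              ∃ w₁ w₂, w = w₁ * w₂ ∧ c.1 p w₁ ∧ c.1 q w₂) →
            (c.1 x y ∧ ∀ p q, (∃ v₁ v₂, x = v₁ * v₂ ∧ c.1 p v₁ ∧ c.1 q v₂) ↔
              ∃ w₁ w₂, y = w₁ * w₂ ∧ c.1 p w₁ ∧ c.1 q w₂) →
            ∀ p q, (∃ v₁ v₂, v * x = v₁ * v₂ ∧ c.1 p v₁ ∧ c.1 q v₂) →
              ∃ w₁ w₂, w * y = w₁ * w₂ ∧ c.1 p w₁ ∧ c.1 q w₂ := by
          rintro v w x y ⟨h1, h2⟩ ⟨h3, h4⟩ p q ⟨z₁, z₂, hz, hp, hq⟩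
          -- The cut of `v * x` falls at the boundary, inside `x`, or inside `v`; only the factor
          -- that is cut needs the recorded set of splittings.
          rcases mul_eq_mul_cases hz with ⟨rfl, rfl⟩ | ⟨s, rfl, rfl⟩ | ⟨s, rfl, rfl⟩
          · exact ⟨w, y, rfl, c.1.trans hp h1, c.1.trans hq h3⟩
          · obtain ⟨w₁, w₂, rfl, h5, h6⟩ := (h4 s q).mp ⟨s, z₂, rfl, c.1.refl _, hq⟩
            exact ⟨w * w₁, w₂, (mul_assoc _ _ _).symm, c.1.trans hp (c.1.mul h1 h5), h6⟩
          · obtain ⟨w₁, w₂, rfl, h5, h6⟩ := (h2 p s).mp ⟨z₁, s, rfl, hp, c.1.refl _⟩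
            exact ⟨w₁, w₂ * y, mul_assoc _ _ _, h5, c.1.trans hq (c.1.mul h6 h3)⟩
        intro v w x y h h'
        refine ⟨c.1.mul h.1 h'.1, fun p q => ⟨key h h' p q, key ?_ ?_ p q⟩⟩
        · exact ⟨c.1.symm h.1, fun p q => (h.2 p q).symm⟩
        · exact ⟨c.1.symm h'.1, fun p q => (h'.2 p q).symm⟩ }
    (fun w => (c.cls w, {pq | ∃ v₁ v₂, w = v₁ * v₂ ∧ pq.1 = c.cls v₁ ∧ pq.2 = c.cls v₂}))
    (by
      intro v w h
      refine ⟨(c.cls_eq_iff _ _).mp (congrArg Prod.fst h), fun p q => ?_⟩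
      have h1 := Set.ext_iff.mp (congrArg Prod.snd h) (c.cls p, c.cls q)
      simpa only [Set.mem_ofPred_eq, FinCon.cls_eq_iff] using h1)

/-- Multiplication is open: a word close to a product factors into words close to the factors. -/
theorem exists_mul_of_coord_split (c : FinCon A) {x y : ProSemi A} {w : FreeSemigroup A}
    (h : (word w).1 c.split = (x * y).1 c.split) :
    ∃ w₁ w₂, w = w₁ * w₂ ∧ (word w₁).1 c = x.1 c ∧ (word w₂).1 c = y.1 c := by
  obtain ⟨v₁, h1, h1'⟩ := exists_word_coord₂ c c.split x
  obtain ⟨v₂, h2, h2'⟩ := exists_word_coord₂ c c.split y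
  have h3 : (word w).1 c.split = (word (v₁ * v₂)).1 c.split := by
    rw [h, map_mul]
    change x.1 c.split * y.1 c.split = (word v₁).1 c.split * (word v₂).1 c.split
    rw [h1', h2']
  rw [word_coord_eq_iff] at h3
  obtain ⟨w₁, w₂, rfl, h4, h5⟩ := (h3.2 v₁ v₂).mpr ⟨v₁, v₂, rfl, c.1.refl _, c.1.refl _⟩
  exact ⟨w₁, w₂, rfl, h1 ▸ ((word_coord_eq_iff c _ _).mpr h4).symm,
    h2 ▸ ((word_coord_eq_iff c _ _).mpr h5).symm⟩

/-- The congruence that records the first `n` letters of a word. -/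
def FinCon.take [Finite A] (n : ℕ) : FinCon A :=
  have : Finite {l : List A // l.length ≤ n} := (List.finite_length_le A n).to_subtype
  FinCon.ofMap (T := {l : List A // l.length ≤ n})
    { r := fun v w => (letters v).take n = (letters w).take n
      iseqv := ⟨fun _ => rfl, fun h => h.symm, fun h h' => h.trans h'⟩
      mul' := by
        intro v w x y h h'
        have key : ∀ v x : FreeSemigroup A, (letters (v * x)).take n =
            ((letters v).take n ++ (letters x).take n).take n := by
          intro v x
          rw [letters_mul, List.take_append, List.take_append, List.take_take, List.take_take,
            min_self, List.length_take]
          congr 1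
          rw [min_eq_left (by omega)]
          congr 1
          omega
        change (letters (v * x)).take n = (letters (w * y)).take n
        rw [key, key]
        change (letters v).take n = (letters w).take n at h
        change (letters x).take n = (letters y).take n at h'
        rw [h, h'] }
    (fun w => ⟨(letters w).take n, by simp⟩) fun _ _ h => congrArg Subtype.val h

/-- Words are isolated points. -/
theorem exists_isolating [Finite A] (w : FreeSemigroup A) :
    ∃ c : FinCon A, ∀ v, (word v).1 c = (word w).1 c → v = w := by
  -- One letter beyond the length of `w` is needed to exclude proper extensions of `w`.
  refine ⟨FinCon.take ((letters w).length + 1), fun v h => letters_injective ?_⟩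
  have h1 : (letters v).take ((letters w).length + 1) =
      (letters w).take ((letters w).length + 1) := (word_coord_eq_iff _ _ _).mp h
  have h2 := congrArg List.length h1
  rw [List.length_take, List.length_take] at h2
  rwa [List.take_of_length_le (by omega), List.take_of_length_le (by omega)] at h1

/-- A word close to `u * x`, with `u` a word, begins with `u`. -/
theorem exists_coord_word_mul [Finite A] (u : FreeSemigroup A) (c : FinCon A) :
    ∃ d : FinCon A, ∀ (x : ProSemi A) (w : FreeSemigroup A), (word w).1 d = (word u * x).1 d →
      ∃ v, w = u * v ∧ (word v).1 c = x.1 c := by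
  obtain ⟨e, he⟩ := exists_isolating u
  refine ⟨(e.inf c).split, fun x w h => ?_⟩
  obtain ⟨w₁, w₂, rfl, h1, h2⟩ := exists_mul_of_coord_split _ h
  obtain rfl := he w₁ (coord_eq_of_le (FinCon.inf_le_left e c) h1)
  exact ⟨w₂, rfl, coord_eq_of_le (FinCon.inf_le_right e c) h2⟩

/-- A word close to `x * y` is a product of a word and of one that is close to `y`. -/
theorem exists_coord_mul (c : FinCon A) :
    ∃ d : FinCon A, ∀ (x y : ProSemi A) (w : FreeSemigroup A), (word w).1 d = (x * y).1 d →
      ∃ u v, w = u * v ∧ (word u).1 c = x.1 c ∧ (word v).1 c = y.1 c :=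
  ⟨c.split, fun _ _ _ h => exists_mul_of_coord_split c h⟩

end Topology

/-! ### Stability -/

section Stability

variable {S : Type u} [Semigroup S] [TopologicalSpace S] [CompactSpace S] [T2Space S]
  [ContinuousMul S]

theorem isClosed_mul_right (y : S) : IsClosed {x : S | ∃ u, x = y * u} := by
  have : {x : S | ∃ u, x = y * u} = Set.range (y * ·) := by
    ext x; simp [eq_comm]
  rw [this]
  exact (isCompact_range (by fun_prop)).isClosed

theorem isClosed_mul_left (y : S) : IsClosed {x : S | ∃ u, x = u * y} := by
  have : {x : S | ∃ u, x = u * y} = Set.range (· * y) := by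
    ext x; simp [eq_comm]
  rw [this]
  exact (isCompact_range (by fun_prop)).isClosed

theorem isClosed_factor (y : S) : IsClosed {x : S | ∃ u v, x = u * y * v} := by
  have : {x : S | ∃ u v, x = u * y * v} = Set.range fun p : S × S => p.1 * y * p.2 := by
    ext x; simp [eq_comm]
  rw [this]
  exact (isCompact_range (by fun_prop)).isClosed

theorem isClosed_setOf_factor (y : S) : IsClosed {x : S | ∃ u v, y = u * x * v} := by
  have : {x : S | ∃ u v, y = u * x * v} =
      (fun p : S × S × S => p.2.1) '' {p : S × S × S | y = p.1 * p.2.1 * p.2.2} := by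
    ext x
    constructor
    · rintro ⟨u, v, h⟩
      exact ⟨(u, x, v), h, rfl⟩
    · rintro ⟨⟨u, _, v⟩, h, rfl⟩
      exact ⟨u, v, h⟩
  rw [this]
  have hc : IsClosed {p : S × S × S | y = p.1 * p.2.1 * p.2.2} :=
    isClosed_eq continuous_const (by fun_prop)
  exact (hc.isCompact.image (by fun_prop)).isClosed

/-- Right stability: if `y u` is a factor-divisor of `y`, it is a prefix-divisor. -/
theorem exists_eq_mul_of_factor {y u s t : S} (h : y = s * (y * u) * t) : ∃ k, y = y * u * k := by
  -- A compact semigroup of right multipliers. An idempotent f in it, with y = syf, satisfies y =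
  -- yf, and f begins with `u`.
  let V : Set S := {v | (∃ s, y = s * y * v) ∧ ∃ k, v = u * k}
  have hVc : IsCompact V := by
    have h1 : IsClosed {v : S | ∃ s, y = s * y * v} := by
      have : {v : S | ∃ s, y = s * y * v} =
          Prod.snd '' {p : S × S | y = p.1 * y * p.2} := by
        ext v; simp
      rw [this]
      have hc : IsClosed {p : S × S | y = p.1 * y * p.2} :=
        isClosed_eq continuous_const (by fun_prop)
      exact (hc.isCompact.image continuous_snd).isClosed
    exact (h1.inter (isClosed_mul_right u)).isCompact
  have hVm : ∀ v ∈ V, ∀ w ∈ V, v * w ∈ V := by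
    rintro v ⟨⟨s, hs⟩, k, rfl⟩ w ⟨⟨s', hs'⟩, -⟩
    refine ⟨⟨s' * s, ?_⟩, k * w, mul_assoc _ _ _⟩
    calc y = s' * y * w := hs'
      _ = s' * (s * y * (u * k)) * w := by rw [← hs]
      _ = s' * s * y * (u * k * w) := by simp only [mul_assoc]
  obtain ⟨f, ⟨⟨s, hs⟩, k, rfl⟩, hf⟩ := exists_idempotent_in_compact_subsemigroup
    (fun r : S => by fun_prop) V
    ⟨u * t, ⟨s, by rw [← mul_assoc, mul_assoc s y u]; exact h⟩, t, rfl⟩ hVc hVm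
  refine ⟨k, ?_⟩
  have : y = y * (u * k) := by
    calc y = s * y * (u * k) := hs
      _ = s * y * ((u * k) * (u * k)) := by rw [hf]
      _ = s * y * (u * k) * (u * k) := by simp only [mul_assoc]
      _ = y * (u * k) := by rw [← hs]
  rw [mul_assoc]
  exact this

/-- Left stability: if `u y` is a factor-divisor of `y`, it is a suffix-divisor. -/
theorem exists_eq_mul_of_factor' {y u s t : S} (h : y = s * (u * y) * t) :
    ∃ k, y = k * (u * y) := by
  have h' : MulOpposite.op y =
      MulOpposite.op t * (MulOpposite.op y * MulOpposite.op u) * MulOpposite.op s := by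
    rw [← MulOpposite.op_mul, ← MulOpposite.op_mul, ← MulOpposite.op_mul, ← mul_assoc]
    exact congrArg _ h
  obtain ⟨k, hk⟩ := exists_eq_mul_of_factor h'
  exact ⟨k.unop, by simpa using congrArg MulOpposite.unop hk⟩

end Stability

/-! ### The idempotent iterate of a substitution -/

section Omega

variable {A : Type u}

theorem iterate_extend_word (φ : FreeSemigroup A →ₙ* FreeSemigroup A) (k : ℕ)
    (w : FreeSemigroup A) : (extend φ)^[k] (word w) = word (iter φ k w) := by
  induction k generalizing w with
  | zero => rfl
  | succ k ih => rw [Function.iterate_succ_apply, extend_word, ih]; rfl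

theorem extend_iter (φ : FreeSemigroup A →ₙ* FreeSemigroup A) (k : ℕ) (x : ProSemi A) :
    extend (iter φ k) x = (extend φ)^[k] x := by
  refine congrFun (denseRange_word.equalizer (continuous_extend _)
    ((continuous_extend φ).iterate k) (funext fun w => ?_)) x
  exact (iterate_extend_word φ k w).symm

theorem extend_coord_congr {B : Type u} (f : FreeSemigroup A →ₙ* FreeSemigroup B) (c : FinCon B)
    {x y : ProSemi A} (h : x.1 (c.comap f) = y.1 (c.comap f)) :
    (extend f x).1 c = (extend f y).1 c :=
  congrArg (quotMap f c) h

/-- Modulo `c`, an iterate is determined by its values on the letters, so only finitely many maps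
occur and the sequence of iterates is ultimately periodic. -/
theorem exists_period [Finite A] (φ : FreeSemigroup A →ₙ* FreeSemigroup A) (c : FinCon A) :
    ∃ i p : ℕ, 0 < p ∧ ∀ k, i ≤ k → ∀ x, ((extend φ)^[k + p] x).1 c = ((extend φ)^[k] x).1 c := by
  let τ : ℕ → A → FinQuot c := fun k d => ((extend φ)^[k] (word (FreeSemigroup.of d))).1 c
  obtain ⟨i, p, hp, hip⟩ : ∃ i p, 0 < p ∧ τ i = τ (i + p) := by
    obtain ⟨i, j, hne, hij⟩ := Finite.exists_ne_map_eq_of_infinite τ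
    rcases lt_or_gt_of_ne hne with hlt | hlt
    · exact ⟨i, j - i, by omega, by rw [hij]; congr 1; omega⟩
    · exact ⟨j, i - j, by omega, by rw [← hij]; congr 1; omega⟩
  have hbase : ∀ x, ((extend φ)^[i + p] x).1 c = ((extend φ)^[i] x).1 c := by
    have hcont : ∀ k : ℕ, Continuous fun z : ProSemi A => ((extend φ)^[k] z).1 c := fun k =>
      (continuous_coord c).comp ((continuous_extend φ).iterate k)
    have hmul : ∀ (k : ℕ) (y z : ProSemi A), ((extend φ)^[k] (y * z)).1 c =
        ((extend φ)^[k] y).1 c * ((extend φ)^[k] z).1 c := fun k y z => by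
      rw [iterate_map_mul]; rfl
    refine fun x => congrFun (denseRange_word.equalizer (hcont _) (hcont _) (funext fun w => ?_)) x
    induction w using FreeSemigroup.recOnMul with
    | ih1 d => exact (congrFun hip d).symm
    | ih2 d w h1 h2 =>
      simp only [Function.comp_apply] at h1 h2 ⊢
      rw [map_mul, hmul, hmul, h1, h2]
  refine ⟨i, p, hp, fun k hk x => ?_⟩
  obtain ⟨d, rfl⟩ := Nat.exists_eq_add_of_le hk
  have := hbase ((extend φ)^[d] x)
  rw [← Function.iterate_add_apply, ← Function.iterate_add_apply] at this
  rw [← this, show i + d + p = i + p + d by omega]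

/-- In each finite quotient, `φ^ω` agrees with all the positive powers of some iterate of `φ`. -/
theorem exists_subOmega_coord [Finite A] (φ : FreeSemigroup A →ₙ* FreeSemigroup A) (c : FinCon A)
    {m : ℕ} (hm : 0 < m) :
    ∃ K : ℕ, 0 < K ∧ m ∣ K ∧
      ∀ j, 0 < j → K ∣ j → ∀ x, (subOmega φ x).1 c = ((extend φ)^[j] x).1 c := by
  obtain ⟨i, p, hp, hper⟩ := exists_period φ c
  have hmul : ∀ t k, i ≤ k → ∀ x, ((extend φ)^[k + p * t] x).1 c = ((extend φ)^[k] x).1 c := by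
    intro t
    induction t with
    | zero => intro k _ x; rfl
    | succ t ih =>
      intro k hk x
      rw [Nat.mul_succ, ← Nat.add_assoc, hper _ (by omega), ih k hk]
  -- A multiple of `m` and of the period that is past the preperiod; all its positive multiples then
  -- act alike modulo `c`.
  let K := m * (p * (i + 1))
  have hK : 0 < K := by positivity
  have hiK : i ≤ K := by
    have h1 : 1 * (1 * (i + 1)) ≤ m * (p * (i + 1)) :=
      Nat.mul_le_mul hm (Nat.mul_le_mul hp le_rfl)
    simp only [K]
    omega
  have hKj : ∀ j, 0 < j → K ∣ j → ∀ x, ((extend φ)^[j] x).1 c = ((extend φ)^[K] x).1 c := by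
    rintro _ hj ⟨t, rfl⟩ x
    obtain ⟨t, rfl⟩ : ∃ s, t = s + 1 := ⟨t - 1, by
      have : t ≠ 0 := by rintro rfl; simp at hj
      omega⟩
    have : K * (t + 1) = K + p * (m * (i + 1) * t) := by simp only [K]; ring
    rw [this, hmul _ _ hiK]
  refine ⟨K, hK, dvd_mul_right _ _, fun j hj hKdj x => ?_⟩
  rw [hKj j hj hKdj]
  have ht := ((continuous_coord c).tendsto _).comp (tendsto_omega_extend φ x)
  refine tendsto_nhds_unique ht (tendsto_nhds_of_eventually_eq ?_)
  filter_upwards [eventually_ge_atTop K] with n hn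
  exact hKj _ (Nat.factorial_pos n) (Nat.dvd_factorial hK hn) x

theorem subOmega_mul [Finite A] (φ : FreeSemigroup A →ₙ* FreeSemigroup A) (x y : ProSemi A) :
    subOmega φ (x * y) = subOmega φ x * subOmega φ y := by
  refine coord_ext fun c => ?_
  obtain ⟨K, hK, -, h⟩ := exists_subOmega_coord φ c one_pos
  change _ = (subOmega φ x).1 c * (subOmega φ y).1 c
  rw [h K hK dvd_rfl, h K hK dvd_rfl, h K hK dvd_rfl, iterate_map_mul]
  rfl

theorem continuous_subOmega [Finite A] (φ : FreeSemigroup A →ₙ* FreeSemigroup A) :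
    Continuous (subOmega φ) := by
  refine continuous_induced_rng.mpr (continuous_pi fun c => ?_)
  obtain ⟨K, hK, -, h⟩ := exists_subOmega_coord φ c one_pos
  have : (fun x => (Subtype.val ∘ subOmega φ) x c) = fun x => ((extend φ)^[K] x).1 c :=
    funext (h K hK dvd_rfl)
  rw [this]
  exact (continuous_coord c).comp ((continuous_extend φ).iterate K)

/-- Modulo `c` the outer ω-power is φ^K. Modulo the pullback of `c` along φ^K the inner one is
φ^{K'} with K ∣ K', and φ^{K+K'} again represents φ^ω. -/
theorem subOmega_idem [Finite A] (φ : FreeSemigroup A →ₙ* FreeSemigroup A) (x : ProSemi A) :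
    subOmega φ (subOmega φ x) = subOmega φ x := by
  refine coord_ext fun c => ?_
  obtain ⟨K, hK, -, h⟩ := exists_subOmega_coord φ c one_pos
  obtain ⟨K', hK', hdvd, h'⟩ := exists_subOmega_coord φ (c.comap (iter φ K)) hK
  rw [h K hK dvd_rfl, ← extend_iter,
    extend_coord_congr _ c (h' K' hK' dvd_rfl x), extend_iter, ← Function.iterate_add_apply,
    ← h _ (by omega) (dvd_add dvd_rfl hdvd)]

/-- An element that lies in the image of all iterates of `φ` is fixed by `φ^ω`. -/
theorem subOmega_eq_self [Finite A] (φ : FreeSemigroup A →ₙ* FreeSemigroup A) {x : ProSemi A}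
    {m : ℕ} (hm : 0 < m) (hx : ∀ k, 0 < k → m ∣ k → ∃ y, x = extend (iter φ k) y) :
    subOmega φ x = x := by
  refine coord_ext fun c => ?_
  obtain ⟨K, hK, hmK, h⟩ := exists_subOmega_coord φ c hm
  obtain ⟨y, rfl⟩ := hx K hK hmK
  rw [h K hK dvd_rfl, extend_iter, ← Function.iterate_add_apply,
    ← h _ (by omega) (dvd_add dvd_rfl dvd_rfl), h K hK dvd_rfl]

theorem tendsto_of_coord {ι : Type*} {l : Filter ι} {f : ι → ProSemi A} {x : ProSemi A}
    (h : ∀ c, ∀ᶠ i in l, (f i).1 c = x.1 c) : Tendsto f l (𝓝 x) := by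
  rw [tendsto_nhds]
  intro U hU hx
  obtain ⟨c, hc⟩ := exists_coord_subset hU hx
  exact (h c).mono fun i hi => hc _ hi

theorem tendsto_subOmega [Finite A] (φ : FreeSemigroup A →ₙ* FreeSemigroup A) {m : ℕ}
    (hm : 0 < m) (x : ProSemi A) :
    Tendsto (fun n : ℕ => (extend φ)^[m * n.factorial] x) atTop (𝓝 (subOmega φ x)) := by
  refine tendsto_of_coord fun c => ?_
  obtain ⟨K, hK, -, h⟩ := exists_subOmega_coord φ c one_pos
  filter_upwards [eventually_ge_atTop K] with n hn
  exact (h _ (by have := Nat.factorial_pos n; positivity)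
    ((Nat.dvd_factorial hK hn).mul_left m) x).symm

end Omega

/-! ### The language of a weakly primitive substitution -/

section Language

variable {A : Type u}

/-- Lets equality of the sets of factors of length two imply equality of the sets of letters. -/
theorem mem_infix_two {l : List A} (hl : 2 ≤ l.length) {d : A} (hd : d ∈ l) :
    ∃ u : List A, u.length = 2 ∧ u <:+: l ∧ d ∈ u := by
  obtain ⟨s, t, rfl⟩ := List.append_of_mem hd
  cases t with
  | cons e t => exact ⟨[d, e], rfl, ⟨s, t, by simp⟩, by simp⟩
  | nil =>
    rcases List.eq_nil_or_concat s with rfl | ⟨s, e, rfl⟩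
    · simp at hl
    · exact ⟨[e, d], rfl, ⟨s, [], by simp⟩, by simp⟩

theorem flatMap_infix {B : Type*} {l m : List A} (h : l <:+: m) (f : A → List B) :
    l.flatMap f <:+: m.flatMap f := by
  obtain ⟨s, t, rfl⟩ := h
  exact ⟨s.flatMap f, t.flatMap f, by simp only [List.flatMap_append]⟩

theorem infix_flatMap_of_mem {B : Type*} {l : List A} {c : A} (h : c ∈ l) (f : A → List B) :
    f c <:+: l.flatMap f := by
  obtain ⟨s, t, rfl⟩ := List.append_of_mem h
  exact ⟨s.flatMap f, t.flatMap f, by simp⟩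

/-- A word that is short compared to the blocks `f c` and that occurs in a concatenation of blocks
occurs in a concatenation of two consecutive blocks. -/
theorem infix_two_blocks {B : Type*} (f : A → List B) {u : List B}
    (hf : ∀ c, u.length ≤ (f c).length) :
    ∀ l : List A, 2 ≤ l.length → u <:+: l.flatMap f →
      ∃ d : List A, d.length = 2 ∧ d <:+: l ∧ u <:+: d.flatMap f
  | [], h, _ => by simp at h
  | [_], h, _ => by simp at h
  | [c, d], _, h => ⟨[c, d], rfl, List.infix_rfl, h⟩
  | c :: d :: e :: l, _, h => by
    obtain ⟨s, t, hst⟩ := h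
    -- An occurrence starting after the first block survives its removal; otherwise it ends within
    -- the second block, as `u` is no longer than that block.
    by_cases hs : (f c).length ≤ s.length
    · obtain ⟨s', rfl⟩ : f c <+: s := List.prefix_of_prefix_length_le
        (l₃ := (c :: d :: e :: l).flatMap f) (by simp) (hst ▸ ⟨u ++ t, by simp⟩) hs
      have h' : u <:+: (d :: e :: l).flatMap f := ⟨s', t, by
        rw [List.flatMap_cons] at hst
        simpa only [List.append_assoc, List.append_cancel_left_eq] using hst⟩
      obtain ⟨p, hp, h1, h2⟩ := infix_two_blocks f hf (d :: e :: l) (by simp) h'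
      exact ⟨p, hp, h1.trans (List.suffix_cons _ _).isInfix, h2⟩
    · refine ⟨[c, d], rfl, ⟨[], e :: l, rfl⟩, ?_⟩
      have h1 : s ++ u <+: f c ++ f d := List.prefix_of_prefix_length_le
        (l₃ := (c :: d :: e :: l).flatMap f) (hst ▸ ⟨t, by simp⟩)
        ⟨(e :: l).flatMap f, by simp⟩ (by
          have := hf d
          simp only [List.length_append]
          omega)
      have h2 : u <:+: s ++ u := (List.suffix_append s u).isInfix
      simpa using h2.trans h1.isInfix

/-- The properties of large iterates of a weakly primitive substitution that are used below; the
set `B` is that of the letters of the language. -/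
structure IsUniform (φ : FreeSemigroup A →ₙ* FreeSemigroup A) (B : Set A) (n : ℕ) : Prop where
  pos : 0 < n
  two_le : ∀ c, 2 ≤ (iter φ n (FreeSemigroup.of c)).length
  mem_iff : ∀ k, n ≤ k → ∀ c d, d ∈ letters (iter φ k (FreeSemigroup.of c)) ↔ d ∈ B
  two_iff : ∀ c d, ∀ u : List A, u.length = 2 → u <:+: letters (iter φ n (FreeSemigroup.of c)) →
    u <:+: letters (iter φ n (FreeSemigroup.of d))

theorem letters_iter_add (φ : FreeSemigroup A →ₙ* FreeSemigroup A) (j k : ℕ)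
    (w : FreeSemigroup A) :
    letters (iter φ (j + k) w) =
      (letters (iter φ k w)).flatMap fun c => letters (iter φ j (FreeSemigroup.of c)) := by
  rw [iter_add_apply, letters_map]

/-- `B` is the set of letters of φⁿ(c), which does not depend on c. Since φ^{n+j}(c) = φⁿ(φ^j(c)),
all later iterates have the same letters. -/
theorem IsWeaklyPrimitive.exists_isUniform {φ : FreeSemigroup A →ₙ* FreeSemigroup A}
    (hφ : IsWeaklyPrimitive φ) : ∃ B n, IsUniform φ B n := by
  obtain ⟨n, hn, h2, hiff⟩ := hφ
  have hsame : ∀ c c' d, d ∈ letters (iter φ n (FreeSemigroup.of c)) →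
      d ∈ letters (iter φ n (FreeSemigroup.of c')) := by
    intro c c' d hd
    obtain ⟨u, hu, hui, hdu⟩ := mem_infix_two (l := letters (iter φ n (FreeSemigroup.of c))) (h2 c) hd
    exact ((hiff c c' u hu).mp hui).subset hdu
  refine ⟨{d | ∃ c, d ∈ letters (iter φ n (FreeSemigroup.of c))}, n, hn, h2, ?_,
    fun c d u hu h => (hiff c d u hu).mp h⟩
  intro k hk c d
  obtain ⟨j, rfl⟩ := Nat.exists_eq_add_of_le hk
  rw [letters_iter_add]
  simp only [List.mem_flatMap, Set.mem_ofPred_eq]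
  constructor
  · rintro ⟨e, -, he⟩
    exact ⟨e, he⟩
  · rintro ⟨c', hc'⟩
    obtain ⟨e, he⟩ := List.exists_mem_of_ne_nil _
      (letters_ne_nil (iter φ j (FreeSemigroup.of c)))
    exact ⟨e, he, hsame c' e d hc'⟩

variable {φ : FreeSemigroup A →ₙ* FreeSemigroup A} {B : Set A} {n : ℕ}

theorem IsUniform.two_mul_length_le (h : IsUniform φ B n) (w : FreeSemigroup A) :
    2 * w.length ≤ (iter φ n w).length := by
  induction w using FreeSemigroup.recOnMul with
  | ih1 c => exact h.two_le c
  | ih2 c w h1 h2 => rw [map_mul, FreeSemigroup.length_mul, FreeSemigroup.length_mul]; omega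

theorem IsUniform.lt_length (h : IsUniform φ B n) (N : ℕ) :
    ∀ k, N * n ≤ k → ∀ c, N < (iter φ k (FreeSemigroup.of c)).length := by
  induction N with
  | zero => intro k _ c; exact length_pos _
  | succ N ih =>
    intro k hk c
    obtain ⟨j, rfl⟩ := Nat.exists_eq_add_of_le (show n ≤ k by
      rw [Nat.succ_mul] at hk
      omega)
    have h1 := ih j (by rw [Nat.succ_mul] at hk; omega) c
    have h2 := h.two_mul_length_le (iter φ j (FreeSemigroup.of c))
    rw [iter_add_apply]
    omega

theorem language_infix {u v : List A} (h : u <:+: v) (hv : v ∈ language φ) : u ∈ language φ := by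
  obtain ⟨c, hc⟩ := hv
  exact ⟨c, hc.mono fun k hk => h.trans hk⟩

theorem language_map {v : List A} (hv : v ∈ language φ) (j : ℕ) :
    (v.flatMap fun c => letters (iter φ j (FreeSemigroup.of c))) ∈ language φ := by
  obtain ⟨c, hc⟩ := hv
  obtain ⟨K, hK⟩ := eventually_atTop.mp hc
  refine ⟨c, eventually_atTop.mpr ⟨j + K, fun k hk => ?_⟩⟩
  obtain ⟨i, rfl⟩ := Nat.exists_eq_add_of_le hk
  have := flatMap_infix (hK (K + i) (by omega)) fun c => letters (iter φ j (FreeSemigroup.of c))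
  rw [← iter_apply, ← letters_iter_add, ← Nat.add_assoc] at this
  exact this

theorem IsUniform.mem_language (h : IsUniform φ B n) {u : List A} {K : ℕ} {c : A} (hc : c ∈ B)
    (hu : u <:+: letters (iter φ K (FreeSemigroup.of c))) : u ∈ language φ := by
  refine ⟨c, eventually_atTop.mpr ⟨K + n, fun k hk => ?_⟩⟩
  obtain ⟨i, rfl⟩ := Nat.exists_eq_add_of_le hk
  rw [← iter_apply, Nat.add_assoc, letters_iter_add]
  exact hu.trans (infix_flatMap_of_mem ((h.mem_iff (n + i) (by omega) c c).mpr hc)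
    fun c => letters (iter φ K (FreeSemigroup.of c)))

/-- For k so large that the blocks φ^k(d) are longer than `u`, an occurrence of `u` in φ^{k+n}(c₀)
lies in the image of a factor of φⁿ(c₀) of length two, and that factor occurs in every φⁿ(c). -/
theorem IsUniform.exists_infix_all (h : IsUniform φ B n) {u : List A} (hu : u ∈ language φ) :
    ∃ K, ∀ c, u <:+: letters (iter φ K (FreeSemigroup.of c)) := by
  obtain ⟨c₀, hc₀⟩ := hu
  obtain ⟨K, hK⟩ := eventually_atTop.mp hc₀
  let k := K + u.length * n
  refine ⟨k + n, fun c => ?_⟩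
  have h1 : u <:+: letters (iter φ (k + n) (FreeSemigroup.of c₀)) := hK _ (by simp only [k]; omega)
  rw [letters_iter_add] at h1 ⊢
  obtain ⟨d, hd, h2, h3⟩ := infix_two_blocks _
    (fun c => (h.lt_length u.length k (by simp only [k]; omega) c).le)
    (letters (iter φ n (FreeSemigroup.of c₀))) (h.two_le c₀) h1
  exact h3.trans (flatMap_infix (h.two_iff c₀ c d hd h2) _)

/-- The words of the language occur properly inside of all large iterates of letters. -/
theorem IsUniform.exists_mul_mul (h : IsUniform φ B n) {u : FreeSemigroup A}
    (hu : letters u ∈ language φ) :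
    ∃ K, ∀ k, K ≤ k → ∀ c, ∃ p q, iter φ k (FreeSemigroup.of c) = p * u * q := by
  obtain ⟨K, hK⟩ := h.exists_infix_all hu
  refine ⟨K + 2 * n, fun k hk c => ?_⟩
  obtain ⟨j, rfl⟩ := Nat.exists_eq_add_of_le (show K ≤ k by omega)
  have hl := h.lt_length 2 j (by omega) c
  rw [← length_letters] at hl
  obtain ⟨d₁, d₂, d₃, l, hl⟩ : ∃ d₁ d₂ d₃ l,
      letters (iter φ j (FreeSemigroup.of c)) = d₁ :: d₂ :: d₃ :: l := by
    generalize letters (iter φ j (FreeSemigroup.of c)) = l at hl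
    rcases l with _ | ⟨d₁, _ | ⟨d₂, _ | ⟨d₃, l⟩⟩⟩
    · simp at hl
    · simp at hl
    · simp at hl
    · exact ⟨d₁, d₂, d₃, l, rfl⟩
  -- Using the second of at least three letters makes both surrounding words nonempty.
  obtain ⟨s, t, hst⟩ := hK d₂
  obtain ⟨p, hp⟩ := exists_letters_eq (l := letters (iter φ K (FreeSemigroup.of d₁)) ++ s)
    (by simp [letters_ne_nil])
  obtain ⟨q, hq⟩ := exists_letters_eq (l := t ++ (letters (iter φ K (FreeSemigroup.of d₃)) ++
    l.flatMap fun c => letters (iter φ K (FreeSemigroup.of c)))) (by simp [letters_ne_nil])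
  refine ⟨p, q, letters_injective ?_⟩
  rw [letters_iter_add, hl, letters_mul, letters_mul, hp, hq]
  simp only [List.flatMap_cons, ← hst, List.append_assoc]

theorem exists_length_bound [Finite A] (f : FreeSemigroup A →ₙ* FreeSemigroup A) :
    ∃ M, ∀ c, (letters (f (FreeSemigroup.of c))).length ≤ M := by
  obtain ⟨M, hM⟩ := (Set.finite_range fun c => (letters (f (FreeSemigroup.of c))).length).bddAbove
  exact ⟨M, fun c => hM ⟨c, rfl⟩⟩

/-- A long factor of a concatenation of blocks contains a block. -/
theorem exists_block_infix {σ : A → List A} {M : ℕ} (hM : ∀ c, (σ c).length ≤ M) {v w : List A}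
    (hv : v <:+: w.flatMap σ) (hl : 2 * M < v.length) : ∃ c, σ c <:+: v := by
  obtain ⟨x, y, hxy⟩ := hv
  have hlen := congrArg List.length hxy
  simp only [List.length_append] at hlen
  obtain ⟨w₁, ⟨w₂, rfl⟩, h1, h2⟩ := exists_cut hM w (n := x.length) (by omega)
  cases w₂ with
  | nil => simp only [List.append_nil] at hlen; omega
  | cons c w₂ =>
    refine ⟨c, ?_⟩
    rw [List.flatMap_append, List.flatMap_cons] at hxy
    obtain ⟨x', hx'⟩ : x <+: w₁.flatMap σ := List.prefix_of_prefix_length_le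
      (l₃ := x ++ v ++ y) ⟨v ++ y, by simp⟩ ⟨_, hxy.symm⟩ h1
    rw [← hx', List.append_assoc, List.append_assoc, List.append_cancel_left_eq] at hxy
    have h3 : x' ++ σ c <+: v := List.prefix_of_prefix_length_le (l₃ := v ++ y)
      ⟨w₂.flatMap σ, by rw [hxy, List.append_assoc]⟩ ⟨y, rfl⟩ (by
        have h4 := congrArg List.length hx'
        have := hM c
        simp only [List.length_append] at h4 ⊢
        omega)
    exact (List.suffix_append x' (σ c)).isInfix.trans h3.isInfix

/-- Each word of the language occurs in all long enough words of the language. -/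
theorem IsUniform.exists_recurrence [Finite A] (h : IsUniform φ B n) {u : List A}
    (hu : u ∈ language φ) : ∃ N, ∀ v ∈ language φ, N < v.length → u <:+: v := by
  obtain ⟨K, hK⟩ := h.exists_infix_all hu
  obtain ⟨M, hM⟩ := exists_length_bound (iter φ K)
  refine ⟨2 * M, fun v hv hl => ?_⟩
  obtain ⟨c, hc⟩ := hv
  obtain ⟨j, hj, hvj⟩ := (hc.and (eventually_ge_atTop K)).exists
  obtain ⟨i, rfl⟩ := Nat.exists_eq_add_of_le hvj
  rw [← iter_apply, letters_iter_add] at hj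
  obtain ⟨d, hd⟩ := exists_block_infix hM hj hl
  exact (hK d).trans hd

end Language

/-! ### Return words -/

section Returns

variable {A : Type u} {φ : FreeSemigroup A →ₙ* FreeSemigroup A} {B : Set A} {n : ℕ} {a b : A}

/-- With x = b⁻¹rb one has r·ba = b·x·a, so the occurrences of ba in r·ba other than as prefix or
suffix are those inside x. -/
theorem mem_shiftedReturns_iff {x : FreeSemigroup A} :
    x ∈ shiftedReturns φ b a ↔ (∃ l, letters x = a :: l) ∧ (∃ l, letters x = l ++ [b]) ∧
      b :: letters x ++ [a] ∈ language φ ∧ ∀ s t, letters x ≠ s ++ [b, a] ++ t := by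
  constructor
  · rintro ⟨r, ⟨hr, hL, hpre, hocc⟩, hx⟩
    have hrba : r ++ [b, a] = b :: letters x ++ [a] := by
      rw [hx]; simp
    obtain ⟨l, hl⟩ := List.exists_cons_of_ne_nil (letters_ne_nil x)
    refine ⟨?_, ?_, hrba ▸ hL, fun s t hst => ?_⟩
    · obtain ⟨l, hl⟩ := hl
      rw [hrba, hl] at hpre
      obtain ⟨t, ht⟩ := hpre
      simp only [List.cons_append, List.cons.injEq] at ht
      exact ⟨l, by rw [hl, ht.2.1]⟩
    · cases r with
      | nil => exact absurd rfl hr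
      | cons d r => exact ⟨r, (List.cons.inj hx).2⟩
    · rcases hocc (b :: s) (t ++ [a]) (by rw [hrba, hst]; simp) with h | h <;> simp at h
  · rintro ⟨⟨l, hl⟩, ⟨l', hl'⟩, hL, hocc⟩
    have hrba : b :: l' ++ [b, a] = b :: letters x ++ [a] := by
      rw [hl']; simp
    refine ⟨b :: l', ⟨by simp, hrba ▸ hL, ?_, fun s t hst => ?_⟩, by rw [hl']; rfl⟩
    · rw [hrba, hl]
      exact ⟨l ++ [a], rfl⟩
    · by_contra! hne
      obtain ⟨hs, ht⟩ := hne
      obtain ⟨d, s, rfl⟩ := List.exists_cons_of_ne_nil hs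
      obtain ⟨t, e, rfl⟩ := (List.eq_nil_or_concat t).resolve_left ht
      rw [hrba] at hst
      simp only [List.concat_eq_append, List.cons_append, List.cons.injEq] at hst
      have h2 := hst.2
      rw [← List.append_assoc] at h2
      exact hocc s t (List.append_inj_left' h2 rfl)

/-- Long words of the language contain ba, whereas elements of X do not. -/
theorem IsUniform.finite_shiftedReturns [Finite A] (h : IsUniform φ B n)
    (hba : [b, a] ∈ language φ) : (shiftedReturns φ b a).Finite := by
  obtain ⟨N, hN⟩ := h.exists_recurrence hba
  refine Set.Finite.subset ((List.finite_length_le A N).preimage letters_injective.injOn) ?_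
  intro x hx
  rw [mem_shiftedReturns_iff] at hx
  by_contra hlt
  obtain ⟨s, t, hst⟩ := hN (letters x) (language_infix ⟨[b], [a], rfl⟩ hx.2.2.1) (not_le.mp hlt)
  exact hx.2.2.2 s t hst.symm

/-- The words that can be placed between two occurrences of `b.a` factor into shifted return
words. -/
theorem exists_inclX_eq (w : FreeSemigroup A) (ha : ∃ l, letters w = a :: l)
    (hb : ∃ l, letters w = l ++ [b]) (hL : b :: letters w ++ [a] ∈ language φ) :
    ∃ y, inclX (shiftedReturns φ b a) y = w := by
  induction hk : w.length using Nat.strong_induction_on generalizing w with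
  | _ k ih =>
    subst hk
    by_cases hocc : ∀ s t, letters w ≠ s ++ [b, a] ++ t
    · exact ⟨FreeSemigroup.of ⟨w, mem_shiftedReturns_iff.mpr ⟨ha, hb, hL, hocc⟩⟩, rfl⟩
    push Not at hocc
    obtain ⟨s, t, hst⟩ := hocc
    obtain ⟨w₁, h1⟩ := exists_letters_eq (l := s ++ [b]) (by simp)
    obtain ⟨w₂, h2⟩ := exists_letters_eq (l := a :: t) (by simp)
    have hw : w = w₁ * w₂ := letters_injective (by rw [letters_mul, h1, h2, hst]; simp)
    have hl : w.length = w₁.length + w₂.length := by rw [hw, FreeSemigroup.length_mul]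
    have hw₁ := length_pos w₁
    have hw₂ := length_pos w₂
    obtain ⟨y₁, hy₁⟩ := ih w₁.length (by omega) w₁ (by
        obtain ⟨l, hl⟩ := ha
        rw [h1]
        rw [hst] at hl
        cases s with
        | nil => exact ⟨[], by simp only [List.nil_append, List.cons_append] at hl ⊢
                               rw [(List.cons.inj hl).1]⟩
        | cons c s => exact ⟨s ++ [b], by rw [List.cons_append, List.cons_append] at hl
                                          rw [List.cons_append, (List.cons.inj hl).1]⟩)
      ⟨s, h1⟩ (language_infix ⟨[], t ++ [a], by rw [h1, hst]; simp⟩ hL) rfl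
    obtain ⟨y₂, hy₂⟩ := ih w₂.length (by omega) w₂ ⟨t, h2⟩ (by
        obtain ⟨l, hl⟩ := hb
        rw [h2]
        rw [hst] at hl
        rcases List.eq_nil_or_concat t with rfl | ⟨t, e, rfl⟩
        · have : s ++ [b] ++ [a] = l ++ [b] := by rw [← hl]; simp
          exact ⟨[], by rw [(List.append_inj' this rfl).2]; rfl⟩
        · have : (s ++ [b, a] ++ t) ++ [e] = l ++ [b] := by rw [← hl]; simp
          have h3 := (List.append_inj' this rfl).2
          exact ⟨a :: t, by rw [List.concat_eq_append, h3]; rfl⟩)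
      (language_infix ⟨b :: s, [], by rw [h2, hst]; simp⟩ hL) rfl
    exact ⟨y₁ * y₂, by rw [map_mul, hy₁, hy₂, hw]⟩

/-! ### The cutting automaton -/

open Classical in
/-- One step of the automaton that cuts a word at the occurrences of `b.a`: the state consists of the
part read since the last cut, with at most `M` letters, and of the product of the labels of
the earlier parts. -/
noncomputable def cutStep (b a : A) (M : ℕ) {K : Type*} [Mul K] (lab : List A → K)
    (q : List A × K) (c : A) : List A × K :=
  if c = a ∧ (q.1 = [] ∨ ∃ l, q.1 = l ++ [b]) then ([c], q.2 * lab q.1)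
  -- The reset on overflow only keeps the state space finite; it is not reached on products of
  -- shifted return words of length at most `M`.
  else (if q.1.length < M then q.1 ++ [c] else [], q.2)

variable {K : Type*} [Monoid K] {lab : List A → K} {M : ℕ}

theorem length_cutStep_le (hM : 0 < M) (q : List A × K) (c : A) :
    (cutStep b a M lab q c).1.length ≤ M := by
  rw [cutStep]
  split_ifs
  · exact hM
  · simp only [List.length_append, List.length_singleton]
    omega
  · simp

theorem length_foldl_cutStep_le (hM : 0 < M) (l : List A) (q : List A × K)
    (hq : q.1.length ≤ M) : (l.foldl (cutStep b a M lab) q).1.length ≤ M := by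
  induction l generalizing q with
  | nil => exact hq
  | cons c l ih => exact ih _ (length_cutStep_le hM q c)

theorem foldl_cutStep_of_no_cut (l l' : List A) (k : K) (hl : l ≠ [])
    (hM : (l ++ l').length ≤ M) (hocc : ∀ s t, l ++ l' ≠ s ++ [b, a] ++ t) :
    l'.foldl (cutStep b a M lab) (l, k) = (l ++ l', k) := by
  induction l' generalizing l with
  | nil => simp
  | cons c l' ih =>
    have h1 : cutStep b a M lab (l, k) c = (l ++ [c], k) := by
      rw [cutStep, if_neg, if_pos]
      · simp only [List.length_append, List.length_cons] at hM ⊢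
        omega
      · rintro ⟨rfl, h | ⟨m, h⟩⟩
        · exact hl h
        · exact hocc m l' (by
            change l = m ++ [b] at h
            rw [h]; simp)
    rw [List.foldl_cons, h1, ih (l ++ [c]) (by simp) (by simpa using hM) (by simpa using hocc)]
    simp

/-- A shifted return word begins with a and contains no ba. Read after a part that is empty or ends
with b, it is therefore cut exactly once, before its first letter. -/
theorem foldl_cutStep_return {x : FreeSemigroup A} (hx : x ∈ shiftedReturns φ b a)
    (hM : (letters x).length ≤ M) (q : List A × K) (hq : q.1 = [] ∨ ∃ l, q.1 = l ++ [b]) :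
    (letters x).foldl (cutStep b a M lab) q = (letters x, q.2 * lab q.1) := by
  obtain ⟨⟨l, hl⟩, -, -, hocc⟩ := mem_shiftedReturns_iff.mp hx
  rw [hl] at hM hocc ⊢
  have h1 : cutStep b a M lab q a = ([a], q.2 * lab q.1) := by
    rw [cutStep, if_pos ⟨rfl, hq⟩]
  rw [List.foldl_cons, h1, foldl_cutStep_of_no_cut [a] l _ (by simp) hM hocc]
  rfl

/-- The automaton computes the product of the labels of a product of shifted return words. -/
theorem foldl_cutStep_inclX (Λ : FreeSemigroup (shiftedReturns φ b a) →ₙ* K)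
    (hΛ : ∀ x, Λ (FreeSemigroup.of x) = lab (letters x.1))
    (hM : ∀ x ∈ shiftedReturns φ b a, (letters x).length ≤ M)
    (y : FreeSemigroup (shiftedReturns φ b a)) (q : List A × K)
    (hq : q.1 = [] ∨ ∃ l, q.1 = l ++ [b]) :
    ((letters (inclX _ y)).foldl (cutStep b a M lab) q).2 *
        lab ((letters (inclX _ y)).foldl (cutStep b a M lab) q).1 = q.2 * lab q.1 * Λ y := by
  induction y using FreeSemigroup.recOnMul generalizing q with
  | ih1 x =>
    change ((letters x.1).foldl (cutStep b a M lab) q).2 * _ = _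
    change _ * lab ((letters x.1).foldl (cutStep b a M lab) q).1 = _
    rw [foldl_cutStep_return x.2 (hM _ x.2) q hq, hΛ]
  | ih2 x y h1 h2 =>
    have h3 : inclX (shiftedReturns φ b a) (FreeSemigroup.of x) = x.1 := rfl
    rw [map_mul, letters_mul, List.foldl_append, h3, foldl_cutStep_return x.2 (hM _ x.2) q hq,
      h2 _ (Or.inr (mem_shiftedReturns_iff.mp x.2).2.1), map_mul, hΛ, mul_assoc]

end Returns

/-! ### Free generation by return words and finite quotients -/

section Returns

variable {A : Type u} {φ : FreeSemigroup A →ₙ* FreeSemigroup A} {a b : A}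

/-- The value 1 at the empty list makes the cut before the first letter of the input harmless. -/
theorem exists_label {K : Type*} [Monoid K] (Λ : FreeSemigroup (shiftedReturns φ b a) →ₙ* K) :
    ∃ lab : List A → K, lab [] = 1 ∧ ∀ x, Λ (FreeSemigroup.of x) = lab (letters x.1) := by
  classical
  refine ⟨fun l => if h : ∃ x : shiftedReturns φ b a, letters x.1 = l
    then Λ (FreeSemigroup.of h.choose) else 1, ?_, fun x => ?_⟩
  · refine dif_neg ?_
    rintro ⟨x, hx⟩
    exact letters_ne_nil _ hx
  · have h : ∃ y : shiftedReturns φ b a, letters y.1 = letters x.1 := ⟨x, rfl⟩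
    change _ = dite _ _ _
    rw [dif_pos h]
    congr 2
    exact (Subtype.ext (letters_injective h.choose_spec)).symm

theorem exists_returns_bound (hfin : (shiftedReturns φ b a).Finite) :
    ∃ M, 0 < M ∧ ∀ x ∈ shiftedReturns φ b a, (letters x).length ≤ M := by
  obtain ⟨M, hM⟩ := (hfin.image fun x => (letters x).length).bddAbove
  exact ⟨M + 1, by omega, fun x hx => (hM ⟨x, hx, rfl⟩).trans (Nat.le_succ M)⟩

/-- The shifted return words freely generate a subsemigroup. -/
theorem inclX_injective (hfin : (shiftedReturns φ b a).Finite) :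
    Function.Injective (inclX (shiftedReturns φ b a)) := by
  classical
  obtain ⟨M, -, hM⟩ := exists_returns_bound hfin
  -- With the generators themselves as labels, the automaton recovers the factorization.
  let Λ : FreeSemigroup (shiftedReturns φ b a) →ₙ* FreeMonoid (shiftedReturns φ b a) :=
    { toFun := fun y => FreeMonoid.ofList (letters y)
      map_mul' := fun _ _ => rfl }
  obtain ⟨lab, hlab, hΛ⟩ := exists_label Λ
  intro y z hyz
  have h1 := foldl_cutStep_inclX Λ hΛ hM y ([], 1) (Or.inl rfl)
  have h2 := foldl_cutStep_inclX Λ hΛ hM z ([], 1) (Or.inl rfl)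
  rw [hyz, h2, mul_right_inj] at h1
  exact letters_injective (FreeMonoid.ofList.injective h1).symm

/-- A homomorphism from the free semigroup on the shifted return words to a finite monoid is
determined by a finite-index congruence on `A⁺`. -/
theorem exists_finCon_inclX [Finite A] (hfin : (shiftedReturns φ b a).Finite) {K : Type*} [Monoid K]
    [Finite K] (Λ : FreeSemigroup (shiftedReturns φ b a) →ₙ* K) :
    ∃ c : FinCon A, ∀ y z, c.1 (inclX _ y) (inclX _ z) → Λ y = Λ z := by
  classical
  obtain ⟨M, hM0, hM⟩ := exists_returns_bound hfin
  obtain ⟨lab, hlab, hΛ⟩ := exists_label Λ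
  have : Finite {l : List A // l.length ≤ M} := (List.finite_length_le A M).to_subtype
  let Q := {l : List A // l.length ≤ M} × K
  let run : FreeSemigroup A → Q → Q := fun w q =>
    let r := (letters w).foldl (cutStep b a M lab) (q.1.1, q.2)
    (⟨r.1, length_foldl_cutStep_le hM0 _ _ q.1.2⟩, r.2)
  have hrun : ∀ v w q, run (v * w) q = run w (run v q) := by
    intro v w q
    simp only [run, letters_mul, List.foldl_append]
  -- The transition congruence of the finite automaton.
  let c : Con (FreeSemigroup A) :=
    { r := fun v w => run v = run w
      iseqv := ⟨fun _ => rfl, fun h => h.symm, fun h h' => h.trans h'⟩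
      mul' := by
        intro v w x y h h'
        funext q
        change run v = run w at h
        change run x = run y at h'
        rw [hrun, hrun, h, h'] }
  refine ⟨FinCon.ofMap c run fun _ _ h => h, fun y z hyz => ?_⟩
  have h0 := congrFun (show run (inclX _ y) = run (inclX _ z) from hyz) (⟨[], by simp⟩, 1)
  have h1 := foldl_cutStep_inclX Λ hΛ hM y ([], 1) (Or.inl rfl)
  have h2 := foldl_cutStep_inclX Λ hΛ hM z ([], 1) (Or.inl rfl)
  have h3 := congrArg (fun q : Q => q.1.1) h0
  have h4 := congrArg (fun q : Q => q.2) h0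
  simp only [run] at h3 h4
  rw [h3, h4, h2] at h1
  simpa [hlab] using h1.symm

end Returns

/-! ### Maximal subgroups of compact semigroups -/

section Core

variable {S : Type u} [Semigroup S]

theorem isPrefixOf_iff {x y : S} : IsPrefixOf y x ↔ x = y ∨ ∃ u, x = y * u := by
  constructor
  · rintro ⟨u, hu⟩
    cases u with
    | one => exact Or.inl (WithOne.coe_injective (by simpa using hu))
    | coe u => exact Or.inr ⟨u, WithOne.coe_injective (by simpa using hu)⟩
  · rintro (rfl | ⟨u, rfl⟩)
    · exact ⟨1, (mul_one _).symm⟩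
    · exact ⟨u, rfl⟩

theorem isSuffixOf_iff {x y : S} : IsSuffixOf y x ↔ x = y ∨ ∃ u, x = u * y := by
  constructor
  · rintro ⟨u, hu⟩
    cases u with
    | one => exact Or.inl (WithOne.coe_injective (by simpa using hu))
    | coe u => exact Or.inr ⟨u, WithOne.coe_injective (by simpa using hu)⟩
  · rintro (rfl | ⟨u, rfl⟩)
    · exact ⟨1, (one_mul _).symm⟩
    · exact ⟨u, rfl⟩

/-- The elements of `α S ∩ S β` that are factors of `α`. -/
def core (α β : S) : Set S := {g | (∃ u, g = α * u) ∧ (∃ v, g = v * β) ∧ ∃ s t, α = s * g * t}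

/-- The relations between `α` and `β` under which `core α β` is a group. -/
structure IsLinked (α β : S) : Prop where
  right : ∃ u, α = α * u
  left : ∃ u, β = u * β
  factor : ∃ s t, β = s * α * t
  link : ∃ s t, α = s * (β * α) * t

variable [TopologicalSpace S] [CompactSpace S] [T2Space S] [ContinuousMul S] {α β : S}

theorem isClosed_core (α β : S) : IsClosed (core α β) :=
  (isClosed_mul_right α).inter ((isClosed_mul_left β).inter (isClosed_setOf_factor α))

theorem exists_eq_mul_of_mem_core {g : S} (hg : g ∈ core α β) : ∃ k, α = g * k := by
  obtain ⟨⟨u, rfl⟩, -, s, t, h⟩ := hg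
  exact exists_eq_mul_of_factor h

theorem IsLinked.exists_eq_mul_of_mem_core (h : IsLinked α β) {g : S} (hg : g ∈ core α β) :
    ∃ k, β = k * g := by
  obtain ⟨-, ⟨v, rfl⟩, s, t, hst⟩ := hg
  obtain ⟨s', t', h'⟩ := h.factor
  refine exists_eq_mul_of_factor' (s := s' * s) (t := t * t') ?_
  calc β = s' * α * t' := h'
    _ = s' * (s * (v * β) * t) * t' := by rw [← hst]
    _ = s' * s * (v * β) * (t * t') := by simp only [mul_assoc]

/-- By stability β ends with g and α begins with g', so gg' is a factor of βα, which by `link` is a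
factor of α. -/
theorem IsLinked.mul_mem_core (h : IsLinked α β) {g g' : S} (hg : g ∈ core α β)
    (hg' : g' ∈ core α β) : g * g' ∈ core α β := by
  obtain ⟨k, hk⟩ := h.exists_eq_mul_of_mem_core hg
  obtain ⟨k', hk'⟩ := Subst.exists_eq_mul_of_mem_core hg'
  obtain ⟨s, t, hst⟩ := h.link
  obtain ⟨u, hu⟩ := hg.1
  obtain ⟨v, hv⟩ := hg'.2.1
  refine ⟨⟨u * g', by rw [hu, mul_assoc]⟩, ⟨g * v, by rw [hv, mul_assoc]⟩, s * k, k' * t, ?_⟩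
  calc α = s * (β * α) * t := hst
    _ = s * (k * g * (g' * k')) * t := by rw [← hk, ← hk']
    _ = s * k * (g * g') * (k' * t) := by simp only [mul_assoc]

/-- A compact semigroup contains an idempotent e. As α ∈ eS and β ∈ Se, it acts as identity on αS
from the left and on Sβ from the right. -/
theorem IsLinked.exists_one (h : IsLinked α β) (hne : (core α β).Nonempty) :
    ∃ e ∈ core α β, ∀ g ∈ core α β, e * g = g ∧ g * e = g := by
  obtain ⟨e, he, hee⟩ := exists_idempotent_in_compact_subsemigroup (fun r : S => by fun_prop)
    (core α β) hne (isClosed_core α β).isCompact fun x hx y hy => h.mul_mem_core hx hy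
  refine ⟨e, he, fun g hg => ?_⟩
  obtain ⟨u, hu⟩ := hg.1
  obtain ⟨v, hv⟩ := hg.2.1
  obtain ⟨k, hk⟩ := Subst.exists_eq_mul_of_mem_core he
  obtain ⟨l, hl⟩ := h.exists_eq_mul_of_mem_core he
  constructor
  · rw [hu, hk, ← mul_assoc, ← mul_assoc, hee]
  · rw [hv, hl, mul_assoc, mul_assoc, hee]

theorem exists_inv_of_mem_core {e : S} (he : e ∈ core α β)
    (hone : ∀ g ∈ core α β, e * g = g ∧ g * e = g) {g : S} (hg : g ∈ core α β) :
    ∃ g' ∈ core α β, g * g' = e := by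
  obtain ⟨k, hk⟩ := Subst.exists_eq_mul_of_mem_core hg
  obtain ⟨k', hk'⟩ := Subst.exists_eq_mul_of_mem_core he
  obtain ⟨u, hu⟩ := he.1
  obtain ⟨v, hv⟩ := he.2.1
  -- From α = gk and e = αu, the element ku is a right inverse of g; multiplying by e on both sides
  -- moves it into the core.
  have h1 : g * (e * (k * u) * e) = e := by
    calc g * (e * (k * u) * e) = g * e * k * u * e := by simp only [mul_assoc]
      _ = g * k * u * e := by rw [(hone g hg).2]
      _ = e * e := by rw [← hk, ← hu]
      _ = e := (hone e he).1
  refine ⟨e * (k * u) * e, ⟨⟨u * (k * u) * e, ?_⟩, ⟨e * (k * u) * v, ?_⟩, g, k', ?_⟩, h1⟩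
  · nth_rewrite 1 [hu]
    simp only [mul_assoc]
  · nth_rewrite 2 [hv]
    simp only [mul_assoc]
  · rw [h1, ← hk']

/-- The group structure of the core. -/
@[reducible]
noncomputable def IsLinked.group (h : IsLinked α β) (hne : (core α β).Nonempty) :
    Group (core α β) :=
  letI : Mul (core α β) := ⟨fun x y => ⟨x.1 * y.1, h.mul_mem_core x.2 y.2⟩⟩
  letI : One (core α β) := ⟨⟨_, (h.exists_one hne).choose_spec.1⟩⟩
  letI : Inv (core α β) := ⟨fun x => ⟨_, (exists_inv_of_mem_core (h.exists_one hne).choose_spec.1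
    (h.exists_one hne).choose_spec.2 x.2).choose_spec.1⟩⟩
  Group.ofRightAxioms (fun x y z => Subtype.ext (mul_assoc x.1 y.1 z.1))
    (fun x => Subtype.ext ((h.exists_one hne).choose_spec.2 x.1 x.2).2)
    (fun x => Subtype.ext (exists_inv_of_mem_core (h.exists_one hne).choose_spec.1
      (h.exists_one hne).choose_spec.2 x.2).choose_spec.2)

theorem IsLinked.mem_core_iff (h : IsLinked α β) (g : S) :
    g ∈ core α β ↔ (IsPrefixOf α g ∧ IsPrefixOf g α) ∧ (IsSuffixOf β g ∧ IsSuffixOf g β) := by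
  constructor
  · intro hg
    exact ⟨⟨isPrefixOf_iff.mpr (Or.inr hg.1),
      isPrefixOf_iff.mpr (Or.inr (Subst.exists_eq_mul_of_mem_core hg))⟩,
      isSuffixOf_iff.mpr (Or.inr hg.2.1),
      isSuffixOf_iff.mpr (Or.inr (h.exists_eq_mul_of_mem_core hg))⟩
  · rintro ⟨⟨h1, h2⟩, h3, -⟩
    obtain ⟨u, hu⟩ := h.right
    obtain ⟨v, hv⟩ := h.left
    have h2' : ∃ k, α = g * k := by
      rcases isPrefixOf_iff.mp h2 with h2 | h2
      · exact ⟨u, by rw [← h2, ← hu]⟩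
      · exact h2
    refine ⟨?_, ?_, ?_⟩
    · rcases isPrefixOf_iff.mp h1 with rfl | h1
      · exact ⟨u, hu⟩
      · exact h1
    · rcases isSuffixOf_iff.mp h3 with rfl | h3
      · exact ⟨v, hv⟩
      · exact h3
    · obtain ⟨k, hk⟩ := h2'
      obtain ⟨s, t, hst⟩ := h.link
      refine ⟨s * β, k * t, ?_⟩
      calc α = s * (β * α) * t := hst
        _ = s * (β * (g * k)) * t := by rw [← hk]
        _ = s * β * g * (k * t) := by simp only [mul_assoc]

end Core

/-! ### The Schützenberger group of a weakly primitive substitution -/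

section Schutzenberger

variable {A : Type u} {φ : FreeSemigroup A →ₙ* FreeSemigroup A} {B : Set A} {n : ℕ} {a b : A}

theorem FixesConnection.pos {m : ℕ} (hm : FixesConnection φ b a m) : 0 < m := hm.1

theorem FixesConnection.iter_prefix {m : ℕ} (hm : FixesConnection φ b a m) (j : ℕ) :
    [a] <+: letters (iter φ (m * j) (FreeSemigroup.of a)) := by
  induction j with
  | zero => exact List.prefix_rfl
  | succ j ih =>
    obtain ⟨l, hl⟩ := hm.2.1
    obtain ⟨l', hl'⟩ := ih
    rw [Nat.mul_succ, letters_iter_add, iter_apply φ m, ← hl, List.flatMap_append,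
      List.flatMap_singleton, ← hl']
    exact ⟨_, (List.append_assoc _ _ _).symm⟩

theorem FixesConnection.iter_suffix {m : ℕ} (hm : FixesConnection φ b a m) (j : ℕ) :
    [b] <:+ letters (iter φ (m * j) (FreeSemigroup.of b)) := by
  induction j with
  | zero => exact List.suffix_rfl
  | succ j ih =>
    obtain ⟨l, hl⟩ := hm.2.2
    obtain ⟨l', hl'⟩ := ih
    rw [Nat.mul_succ, letters_iter_add, iter_apply φ m, ← hl, List.flatMap_append,
      List.flatMap_singleton, ← hl']
    exact ⟨_, List.append_assoc _ _ _⟩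

theorem IsUniform.mem_of_language (h : IsUniform φ B n) {u : List A} (hu : u ∈ language φ) {c : A}
    (hc : c ∈ u) : c ∈ B := by
  obtain ⟨d, hd⟩ := hu
  obtain ⟨k, hk, hkn⟩ := (hd.and (eventually_ge_atTop n)).exists
  exact (h.mem_iff k hkn d c).mp (hk.subset hc)

theorem IsUniform.singleton_mem_language (h : IsUniform φ B n) {c : A} (hc : c ∈ B) :
    [c] ∈ language φ :=
  h.mem_language (K := 0) hc List.infix_rfl

theorem eq_of_mul_of_prefix {w : FreeSemigroup A} {l : List A} (h : letters w = a :: l) :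
    w = FreeSemigroup.of a ∨ ∃ v, w = FreeSemigroup.of a * v := by
  by_cases hl : l = []
  · exact Or.inl (letters_injective (by rw [h, hl]; rfl))
  · obtain ⟨v, rfl⟩ := exists_letters_eq hl
    exact Or.inr ⟨v, letters_injective h⟩

theorem eq_of_mul_of_suffix {w : FreeSemigroup A} {l : List A} (h : letters w = l ++ [b]) :
    w = FreeSemigroup.of b ∨ ∃ v, w = v * FreeSemigroup.of b := by
  by_cases hl : l = []
  · exact Or.inl (letters_injective (by rw [h, hl]; rfl))
  · obtain ⟨v, rfl⟩ := exists_letters_eq hl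
    exact Or.inr ⟨v, letters_injective h⟩

theorem toGroup_eq_posWord (w : FreeSemigroup A) : toGroup w = posWord (letters w) := by
  induction w using FreeSemigroup.recOnMul with
  | ih1 c => rfl
  | ih2 c w h1 h2 => rw [map_mul, h1, h2, letters_mul, posWord_append]

theorem substHom_eq_grpHom (φ : FreeSemigroup A →ₙ* FreeSemigroup A) :
    substHom φ = grpHom fun c => letters (φ (FreeSemigroup.of c)) := by
  ext c
  rw [substHom, grpHom, FreeGroup.lift_apply_of, FreeGroup.lift_apply_of, toGroup_eq_posWord]

theorem substHom_of (φ : FreeSemigroup A →ₙ* FreeSemigroup A) (c : A) :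
    substHom φ (FreeGroup.of c) = toGroup (φ (FreeSemigroup.of c)) := FreeGroup.lift_apply_of

theorem substHom_toGroup (φ : FreeSemigroup A →ₙ* FreeSemigroup A) (w : FreeSemigroup A) :
    substHom φ (toGroup w) = toGroup (φ w) := by
  rw [substHom_eq_grpHom, toGroup_eq_posWord, grpHom_posWord, toGroup_eq_posWord, letters_map]

theorem substHom_iter (φ : FreeSemigroup A →ₙ* FreeSemigroup A) (k : ℕ) (g : FreeGroup A) :
    substHom (iter φ k) g = (substHom φ)^[k] g := by
  induction k generalizing g with
  | zero =>
    have : substHom (iter φ 0) = MonoidHom.id _ := by ext c; simp [substHom, iter_apply, toGroup]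
    rw [this]; rfl
  | succ k ih =>
    have : substHom (iter φ (k + 1)) = (substHom (iter φ k)).comp (substHom φ) := by
      ext c
      rw [MonoidHom.comp_apply, substHom_of, substHom_of, substHom_toGroup]
      rfl
    rw [this, MonoidHom.comp_apply, ih, Function.iterate_succ_apply]

theorem IsUniform.map_mem (h : IsUniform φ B n) {c d : A} (hc : c ∈ B)
    (hd : d ∈ letters (φ (FreeSemigroup.of c))) : d ∈ B := by
  have h1 := (h.mem_iff n le_rfl c c).mpr hc
  refine (h.mem_iff (1 + n) (by omega) c d).mp ?_
  rw [letters_iter_add]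
  exact List.mem_flatMap.mpr ⟨c, h1, hd⟩

variable [Finite A]

/-- Closed sets absorb the limit along the exponents m·n!. -/
theorem subOmega_word_mem {T : Set (ProSemi A)} (hT : IsClosed T) {m : ℕ} (hm : 0 < m)
    {w : FreeSemigroup A} (h : ∃ K, ∀ j, K ≤ j → word (iter φ (m * j) w) ∈ T) :
    subOmega φ (word w) ∈ T := by
  obtain ⟨K, hK⟩ := h
  refine hT.mem_of_tendsto (tendsto_subOmega φ hm (word w)) ?_
  filter_upwards [eventually_ge_atTop K] with j hj
  rw [iterate_extend_word]
  exact hK _ (hj.trans (Nat.self_le_factorial j))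

/-- A word close to `x * u`, with `u` a word, ends with `u`. -/
theorem exists_coord_mul_word (u : FreeSemigroup A) :
    ∃ d : FinCon A, ∀ (x : ProSemi A) (w : FreeSemigroup A), (word w).1 d = (x * word u).1 d →
      ∃ v, w = v * u := by
  obtain ⟨e, he⟩ := exists_isolating u
  refine ⟨e.split, fun x w h => ?_⟩
  obtain ⟨w₁, w₂, rfl, -, h2⟩ := exists_mul_of_coord_split _ h
  exact ⟨w₁, by rw [he w₂ h2]⟩

/-- The first letter of φ^ω(a) and the last of φ^ω(b) are visible in finite quotients, where φ^ω
coincides with an iterate of φ; one exponent serves both. -/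
theorem exists_fixesConnection (hba : IsConnection φ b a) : ∃ m, FixesConnection φ b a m := by
  obtain ⟨-, ha, hb⟩ := hba
  have hA : ∃ c : FinCon A, ∀ w, (word w).1 c = (subOmega φ (letter a)).1 c →
      [a] <+: letters w := by
    rcases isPrefixOf_iff.mp ha with h | ⟨u, h⟩
    · obtain ⟨c, hc⟩ := exists_isolating (FreeSemigroup.of a)
      refine ⟨c, fun w hw => ?_⟩
      rw [h] at hw
      rw [hc w hw, letters_of]
    · obtain ⟨c, hc⟩ := exists_coord_word_mul (FreeSemigroup.of a) (FinCon.top A)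
      refine ⟨c, fun w hw => ?_⟩
      rw [h] at hw
      obtain ⟨v, rfl, -⟩ := hc u w hw
      exact ⟨letters v, rfl⟩
  have hB : ∃ c : FinCon A, ∀ w, (word w).1 c = (subOmega φ (letter b)).1 c →
      [b] <:+ letters w := by
    rcases isSuffixOf_iff.mp hb with h | ⟨u, h⟩
    · obtain ⟨c, hc⟩ := exists_isolating (FreeSemigroup.of b)
      refine ⟨c, fun w hw => ?_⟩
      rw [h] at hw
      rw [hc w hw, letters_of]
    · obtain ⟨c, hc⟩ := exists_coord_mul_word (FreeSemigroup.of b)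
      refine ⟨c, fun w hw => ?_⟩
      rw [h] at hw
      obtain ⟨v, rfl⟩ := hc u w hw
      exact ⟨letters v, rfl⟩
  obtain ⟨c, hc⟩ := hA
  obtain ⟨d, hd⟩ := hB
  obtain ⟨K, hK, -, h1⟩ := exists_subOmega_coord φ c one_pos
  obtain ⟨K', hK', hdvd, h2⟩ := exists_subOmega_coord φ d hK
  refine ⟨K', hK', hc _ ?_, hd _ ?_⟩
  · rw [h1 K' hK' hdvd, letter, iterate_extend_word]; rfl
  · rw [h2 K' hK' dvd_rfl, letter, iterate_extend_word]; rfl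

/-- The images under `φ^ω` of the words of the language are factors of `φ^ω(c)`. -/
theorem IsUniform.subOmega_factor (h : IsUniform φ B n) {u : FreeSemigroup A}
    (hu : letters u ∈ language φ) (c : A) :
    ∃ s t, subOmega φ (letter c) = s * subOmega φ (word u) * t := by
  have hT := isClosed_factor (subOmega φ (word u))
  obtain ⟨K, hK⟩ := h.exists_mul_mul hu
  refine mem_of_isClosed_of_coord hT fun d => ?_
  obtain ⟨K', hK', -, hd⟩ := exists_subOmega_coord φ d one_pos
  obtain ⟨p, q, hpq⟩ := hK (K' * (K + 1)) (by
    have := Nat.mul_le_mul_right (K + 1) hK'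
    omega) c
  -- Here puq = φ^{K'(K+1)}(c), and modulo `d` a further φ^ω leaves the class of φ^ω(c) unchanged.
  refine ⟨subOmega φ (word (p * u * q)), ⟨subOmega φ (word p), subOmega φ (word q), ?_⟩, ?_⟩
  · rw [map_mul, map_mul, subOmega_mul, subOmega_mul]
  · rw [← hpq, ← iterate_extend_word, hd K' hK' dvd_rfl, ← Function.iterate_add_apply,
      ← hd _ (by omega) (dvd_add dvd_rfl (dvd_mul_right _ _))]
    rfl

theorem IsUniform.isLinked (h : IsUniform φ B n) (hba : [b, a] ∈ language φ) :
    IsLinked (subOmega φ (letter a)) (subOmega φ (letter b)) := by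
  have haB : [a] ∈ language φ := language_infix ⟨[b], [], rfl⟩ hba
  have hbB : [b] ∈ language φ := language_infix ⟨[], [a], rfl⟩ hba
  refine ⟨?_, ?_, h.subOmega_factor (u := FreeSemigroup.of a) haB b, ?_⟩
  · obtain ⟨s, t, hst⟩ := h.subOmega_factor (u := FreeSemigroup.of a) haB a
    change subOmega φ (letter a) = s * subOmega φ (letter a) * t at hst
    -- Iterating α = sαt once gives α = s²(αt)t, and stability removes the left factor.
    obtain ⟨k, hk⟩ := exists_eq_mul_of_factor (y := subOmega φ (letter a)) (u := t) (s := s * s)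
      (t := t) (by
        conv_lhs => rw [hst, hst]
        simp only [mul_assoc])
    exact ⟨t * k, by rw [← mul_assoc]; exact hk⟩
  · obtain ⟨s, t, hst⟩ := h.subOmega_factor (u := FreeSemigroup.of b) hbB b
    change subOmega φ (letter b) = s * subOmega φ (letter b) * t at hst
    obtain ⟨k, hk⟩ := exists_eq_mul_of_factor' (y := subOmega φ (letter b)) (u := s) (s := s)
      (t := t * t) (by
        conv_lhs => rw [hst, hst]
        simp only [mul_assoc])
    exact ⟨k * s, by rw [mul_assoc]; exact hk⟩
  · have := h.subOmega_factor (u := FreeSemigroup.of b * FreeSemigroup.of a) hba a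
    rwa [map_mul, subOmega_mul] at this

theorem IsUniform.schutzenbergerGroup_eq (h : IsUniform φ B n) (hba : [b, a] ∈ language φ) :
    schutzenbergerGroup φ b a = core (subOmega φ (letter a)) (subOmega φ (letter b)) :=
  Set.ext fun g => ((h.isLinked hba).mem_core_iff g).symm

theorem IsUniform.subOmega_mem_core (h : IsUniform φ B n) (hba : [b, a] ∈ language φ)
    {w : FreeSemigroup A} (ha : ∃ l, letters w = a :: l) (hb : ∃ l, letters w = l ++ [b])
    (hw : letters w ∈ language φ) :
    subOmega φ (word w) ∈ core (subOmega φ (letter a)) (subOmega φ (letter b)) := by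
  obtain ⟨l, hl⟩ := ha
  obtain ⟨l', hl'⟩ := hb
  refine ⟨?_, ?_, h.subOmega_factor hw a⟩
  · rcases eq_of_mul_of_prefix hl with rfl | ⟨v, rfl⟩
    · exact (h.isLinked hba).right
    · exact ⟨subOmega φ (word v), by rw [map_mul, subOmega_mul]; rfl⟩
  · rcases eq_of_mul_of_suffix hl' with rfl | ⟨v, rfl⟩
    · exact (h.isLinked hba).left
    · exact ⟨subOmega φ (word v), by rw [map_mul, subOmega_mul]; rfl⟩

theorem IsUniform.subOmega_inclX_mem_core (h : IsUniform φ B n) (hba : [b, a] ∈ language φ)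
    (y : FreeSemigroup (shiftedReturns φ b a)) :
    subOmega φ (word (inclX _ y)) ∈ core (subOmega φ (letter a)) (subOmega φ (letter b)) := by
  induction y using FreeSemigroup.recOnMul with
  | ih1 x =>
    obtain ⟨h1, h2, h3, -⟩ := mem_shiftedReturns_iff.mp x.2
    exact h.subOmega_mem_core hba h1 h2 (language_infix ⟨[b], [a], rfl⟩ h3)
  | ih2 x y h1 h2 =>
    rw [map_mul, map_mul, subOmega_mul]
    exact (h.isLinked hba).mul_mem_core h1 h2

/-- If φ^{mK}(a) = p·ba·q, then pb begins with a and ends with b. -/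
theorem IsUniform.core_nonempty (h : IsUniform φ B n) (hba : [b, a] ∈ language φ) {m : ℕ}
    (hm : FixesConnection φ b a m) :
    (core (subOmega φ (letter a)) (subOmega φ (letter b))).Nonempty := by
  obtain ⟨K, hK⟩ := h.exists_mul_mul (u := FreeSemigroup.of b * FreeSemigroup.of a) hba
  obtain ⟨p, q, hpq⟩ := hK (m * K) (Nat.le_mul_of_pos_left K hm.pos) a
  have hpq' := congrArg letters hpq
  obtain ⟨t, ht⟩ := hm.iter_prefix K
  refine ⟨_, h.subOmega_mem_core hba (w := p * FreeSemigroup.of b) ?_ ⟨letters p, rfl⟩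
    (h.mem_language (K := m * K) (c := a) (h.mem_of_language hba (by simp)) ?_)⟩
  · rw [← ht] at hpq'
    refine ⟨p.tail ++ [b], ?_⟩
    have : a = p.head := (List.cons.inj hpq').1
    rw [this]
    rfl
  · rw [hpq']
    exact ⟨[], a :: letters q, by simp [letters_mul, letters_of]⟩

/-- An iterate may equal `P`, so the limit may be `word P` itself; the hypothesis `hx` covers that
case. -/
theorem exists_eq_word_mul {x : ProSemi A} (hx : ∃ u, x = x * u) {P : FreeSemigroup A} {m : ℕ}
    (hm : 0 < m) {w : FreeSemigroup A} (hw : x = subOmega φ (word w))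
    (h : ∃ K, ∀ j, K ≤ j → letters P <+: letters (iter φ (m * j) w)) : ∃ u, x = word P * u := by
  have hT : IsClosed ({word P} ∪ {x : ProSemi A | ∃ u, x = word P * u}) :=
    isClosed_singleton.union (isClosed_mul_right _)
  have : subOmega φ (word w) ∈ {word P} ∪ {x : ProSemi A | ∃ u, x = word P * u} := by
    obtain ⟨K, hK⟩ := h
    refine subOmega_word_mem hT hm ⟨K, fun j hj => ?_⟩
    obtain ⟨l, hl⟩ := hK j hj
    by_cases hl' : l = []
    · left
      rw [hl', List.append_nil] at hl
      exact congrArg word (letters_injective hl.symm)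
    · obtain ⟨v, rfl⟩ := exists_letters_eq hl'
      refine Or.inr ⟨word v, ?_⟩
      rw [← map_mul]
      exact congrArg word (letters_injective hl.symm)
  rw [← hw] at this
  obtain ⟨u, hu⟩ := hx
  rcases this with h1 | h1
  · exact ⟨u, by rw [← Set.mem_singleton_iff.mp h1]; exact hu⟩
  · exact h1

theorem exists_eq_mul_word {x : ProSemi A} (hx : ∃ u, x = u * x) {P : FreeSemigroup A} {m : ℕ}
    (hm : 0 < m) {w : FreeSemigroup A} (hw : x = subOmega φ (word w))
    (h : ∃ K, ∀ j, K ≤ j → letters P <:+ letters (iter φ (m * j) w)) : ∃ u, x = u * word P := by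
  have hT : IsClosed ({word P} ∪ {x : ProSemi A | ∃ u, x = u * word P}) :=
    isClosed_singleton.union (isClosed_mul_left _)
  have : subOmega φ (word w) ∈ {word P} ∪ {x : ProSemi A | ∃ u, x = u * word P} := by
    obtain ⟨K, hK⟩ := h
    refine subOmega_word_mem hT hm ⟨K, fun j hj => ?_⟩
    obtain ⟨l, hl⟩ := hK j hj
    by_cases hl' : l = []
    · left
      rw [hl', List.nil_append] at hl
      exact congrArg word (letters_injective hl.symm)
    · obtain ⟨v, rfl⟩ := exists_letters_eq hl'
      refine Or.inr ⟨word v, ?_⟩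
      rw [← map_mul]
      exact congrArg word (letters_injective hl.symm)
  rw [← hw] at this
  obtain ⟨u, hu⟩ := hx
  rcases this with h1 | h1
  · exact ⟨u, by rw [← Set.mem_singleton_iff.mp h1]; exact hu⟩
  · exact h1

/-- The elements of the group are limits of words of the language that begin with a given
iterate of `a` and end with a given iterate of `b`. -/
theorem IsUniform.exists_approx (h : IsUniform φ B n) (hba : [b, a] ∈ language φ) {m : ℕ}
    (hm : FixesConnection φ b a m) {g : ProSemi A}
    (hg : g ∈ core (subOmega φ (letter a)) (subOmega φ (letter b))) (c : FinCon A) (j N₀ : ℕ) :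
    ∃ x N s t, N₀ ≤ N ∧
      (word (iter φ (m * j) (FreeSemigroup.of a) * x * iter φ (m * j) (FreeSemigroup.of b))).1 c =
        g.1 c ∧
      iter φ N (FreeSemigroup.of a) = s * (FreeSemigroup.of b *
        (iter φ (m * j) (FreeSemigroup.of a) * (x * (iter φ (m * j) (FreeSemigroup.of b) *
          (FreeSemigroup.of a * t))))) := by
  have hl := h.isLinked hba
  obtain ⟨e, he, hone⟩ := hl.exists_one (h.core_nonempty hba hm)
  set P := iter φ (m * j) (FreeSemigroup.of a) with hP
  set Q := iter φ (m * j) (FreeSemigroup.of b) with hQ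
  have hpre : ∀ i, j ≤ i → letters P <+: letters (iter φ (m * i) (FreeSemigroup.of a)) := by
    intro i hi
    obtain ⟨d, rfl⟩ := Nat.exists_eq_add_of_le hi
    obtain ⟨l, hl⟩ := hm.iter_prefix d
    rw [Nat.mul_add, letters_iter_add, ← hl, List.flatMap_append, List.flatMap_singleton]
    exact List.prefix_append _ _
  have hsuf : ∀ i, j ≤ i → letters Q <:+ letters (iter φ (m * i) (FreeSemigroup.of b)) := by
    intro i hi
    obtain ⟨d, rfl⟩ := Nat.exists_eq_add_of_le hi
    obtain ⟨l, hl⟩ := hm.iter_suffix d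
    rw [Nat.mul_add, letters_iter_add, ← hl, List.flatMap_append, List.flatMap_singleton]
    exact List.suffix_append _ _
  obtain ⟨u₀, hu₀⟩ := he.1
  obtain ⟨v₀, hv₀⟩ := he.2.1
  obtain ⟨u₁, hu₁⟩ : ∃ u, e = word P * u := by
    obtain ⟨u, hu⟩ := exists_eq_word_mul hl.right hm.pos rfl ⟨j, hpre⟩
    exact ⟨u * u₀, by rw [← mul_assoc, ← hu]; exact hu₀⟩
  obtain ⟨v₁, hv₁⟩ : ∃ v, e = v * word Q := by
    obtain ⟨v, hv⟩ := exists_eq_mul_word hl.left hm.pos rfl ⟨j, hsuf⟩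
    exact ⟨v₀ * v, by rw [mul_assoc, ← hv]; exact hv₀⟩
  obtain ⟨u₂, hu₂⟩ : ∃ u, e = word (FreeSemigroup.of a) * u := by
    obtain ⟨u, hu⟩ := exists_eq_word_mul (P := FreeSemigroup.of a) hl.right hm.pos rfl
      ⟨0, fun i _ => hm.iter_prefix i⟩
    exact ⟨u * u₀, by rw [← mul_assoc, ← hu]; exact hu₀⟩
  obtain ⟨v₂, hv₂⟩ : ∃ v, e = v * word (FreeSemigroup.of b) := by
    obtain ⟨v, hv⟩ := exists_eq_mul_word (P := FreeSemigroup.of b) hl.left hm.pos rfl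
      ⟨0, fun i _ => hm.iter_suffix i⟩
    exact ⟨v₀ * v, by rw [mul_assoc, ← hv]; exact hv₀⟩
  -- The identity e of the group begins with P and ends with Q, and so does g = ege. Since e also
  -- ends with b and begins with a, g can be flanked by these letters inside α.
  have hgPQ : g = word P * (u₁ * g * v₁) * word Q := by
    calc g = e * g * e := by rw [(hone g hg).1, (hone g hg).2]
      _ = word P * u₁ * g * (v₁ * word Q) := by rw [← hu₁, ← hv₁]
      _ = word P * (u₁ * g * v₁) * word Q := by simp only [mul_assoc]
  obtain ⟨s, t, hst⟩ := hg.2.2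
  have hα : subOmega φ (letter a) = (s * v₂) * (word (FreeSemigroup.of b) * (word P *
      ((u₁ * g * v₁) * (word Q * (word (FreeSemigroup.of a) * (u₂ * t)))))) := by
    calc subOmega φ (letter a) = s * g * t := hst
      _ = s * (e * g * e) * t := by rw [(hone g hg).1, (hone g hg).2]
      _ = s * (v₂ * word (FreeSemigroup.of b) * (word P * (u₁ * g * v₁) * word Q) *
          (word (FreeSemigroup.of a) * u₂)) * t := by rw [← hgPQ, ← hv₂, ← hu₂]
      _ = _ := by simp only [mul_assoc]
  -- The congruences are chosen from the innermost factor outwards, so that an iterate φ^N(a) close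
  -- to α can be factored one step at a time.
  obtain ⟨d₅, hd₅⟩ := exists_coord_word_mul (FreeSemigroup.of a) (FinCon.top A)
  obtain ⟨d₄, hd₄⟩ := exists_coord_word_mul Q d₅
  obtain ⟨d₃, hd₃⟩ := exists_coord_mul (c.inf d₄)
  obtain ⟨d₂, hd₂⟩ := exists_coord_word_mul P d₃
  obtain ⟨d₁, hd₁⟩ := exists_coord_word_mul (FreeSemigroup.of b) d₂
  obtain ⟨d₀, hd₀⟩ := exists_coord_mul d₁
  obtain ⟨K, hK, -, hKd⟩ := exists_subOmega_coord φ d₀ one_pos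
  have hN := hKd (K * (N₀ + 1)) (by positivity) (dvd_mul_right _ _) (letter a)
  rw [letter, iterate_extend_word] at hN
  change (subOmega φ (letter a)).1 d₀ = _ at hN
  rw [hα] at hN
  obtain ⟨s', y₀, e₀, -, k₀⟩ := hd₀ _ _ _ hN.symm
  obtain ⟨y₁, e₁, k₁⟩ := hd₁ _ _ k₀
  obtain ⟨y₂, e₂, k₂⟩ := hd₂ _ _ k₁
  obtain ⟨x, y₃, e₃, kx, k₃⟩ := hd₃ _ _ _ k₂
  obtain ⟨y₄, e₄, k₄⟩ := hd₄ _ _ (coord_eq_of_le (FinCon.inf_le_right c d₄) k₃)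
  obtain ⟨t', e₅, -⟩ := hd₅ _ _ k₄
  refine ⟨x, K * (N₀ + 1), s', t', ?_, ?_, ?_⟩
  · have := Nat.mul_le_mul_right (N₀ + 1) hK
    omega
  · have hx := coord_eq_of_le (FinCon.inf_le_left c d₄) kx
    rw [map_mul, map_mul]
    conv_rhs => rw [hgPQ]
    change (word P).1 c * (word x).1 c * (word Q).1 c = (word P).1 c * (u₁ * g * v₁).1 c * _
    rw [hx]
  · rw [e₀, e₁, e₂, e₃, e₄, e₅]

/-- The group is contained in the closure of the subsemigroup generated by the shifted return
words. -/
theorem IsUniform.core_subset_closure (h : IsUniform φ B n) (hba : [b, a] ∈ language φ) {m : ℕ}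
    (hm : FixesConnection φ b a m) :
    core (subOmega φ (letter a)) (subOmega φ (letter b)) ⊆
      closure (Set.range fun y => word (inclX (shiftedReturns φ b a) y)) := by
  intro g hg
  refine mem_of_isClosed_of_coord isClosed_closure fun c => ?_
  -- For exponent 0 the end blocks are the letters a and b.
  obtain ⟨x, N, s, t, -, hc, hN⟩ := h.exists_approx hba hm hg c 0 0
  obtain ⟨y, hy⟩ := exists_inclX_eq (φ := φ) (a := a) (b := b)
    (FreeSemigroup.of a * x * FreeSemigroup.of b) ⟨letters x ++ [b], rfl⟩
    ⟨a :: letters x, rfl⟩ (h.mem_language (h.mem_of_language hba (by simp)) (K := N) (c := a)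
      ⟨letters s, letters t, by
        rw [hN]
        simp [letters_mul, letters_of, iter_apply]⟩)
  refine ⟨_, subset_closure ⟨y, rfl⟩, ?_⟩
  simp only [hy]
  exact hc

/-- The congruence that records the letters that occur in a word. -/
def FinCon.content (A : Type u) [Finite A] : FinCon A :=
  FinCon.ofMap (T := Set A)
    { r := fun v w => ∀ d, d ∈ letters v ↔ d ∈ letters w
      iseqv := ⟨fun _ _ => Iff.rfl, fun h d => (h d).symm, fun h h' d => (h d).trans (h' d)⟩
      mul' := fun {v w x y} h h' d => by
        simp only [letters_mul, List.mem_append, h d, h' d] }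
    (fun w => {d | d ∈ letters w}) fun _ _ h d => Set.ext_iff.mp h d

theorem exists_word_content_mul {x y : ProSemi A} {d : A}
    (h : (∃ w, (word w).1 (FinCon.content A) = x.1 (FinCon.content A) ∧ d ∈ letters w) ∨
      ∃ w, (word w).1 (FinCon.content A) = y.1 (FinCon.content A) ∧ d ∈ letters w) :
    ∃ w, (word w).1 (FinCon.content A) = (x * y).1 (FinCon.content A) ∧ d ∈ letters w := by
  have key : ∀ v w : FreeSemigroup A, (word v).1 (FinCon.content A) = x.1 (FinCon.content A) →
      (word w).1 (FinCon.content A) = y.1 (FinCon.content A) →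
      (word (v * w)).1 (FinCon.content A) = (x * y).1 (FinCon.content A) := by
    intro v w hv hw
    rw [map_mul, coord_mul, coord_mul, hv, hw]
  rcases h with ⟨v, hv, hd⟩ | ⟨w, hw, hd⟩
  · obtain ⟨w, hw⟩ := exists_word_coord (FinCon.content A) y
    exact ⟨v * w, key v w hv hw, by rw [letters_mul]; exact List.mem_append_left _ hd⟩
  · obtain ⟨v, hv⟩ := exists_word_coord (FinCon.content A) x
    exact ⟨v * w, key v w hv hw, by rw [letters_mul]; exact List.mem_append_right _ hd⟩

/-- The set of letters is read in a finite quotient, where φ^ω is a large iterate of φ; conversely,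
each letter of B occurs properly inside all large iterates, and this passes to the limit. -/
theorem IsUniform.persistent_eq (h : IsUniform φ B n) : persistent φ = B := by
  refine Set.Subset.antisymm ?_ fun d hd => ?_
  · rintro d ⟨c, u, v, huv⟩
    have hd : ∃ w, (word w).1 (FinCon.content A) = (letter d).1 (FinCon.content A) ∧
        d ∈ letters w := ⟨FreeSemigroup.of d, rfl, by simp [letters_of]⟩
    have hx : ∃ w, (word w).1 (FinCon.content A) =
        (subOmega φ (letter c)).1 (FinCon.content A) ∧ d ∈ letters w := by
      cases u with
      | one =>
        cases v with
        | one =>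
          have huv' : subOmega φ (letter c) = letter d :=
            WithOne.coe_injective (by simpa using huv)
          rwa [huv']
        | coe v =>
          have huv' : subOmega φ (letter c) = letter d * v :=
            WithOne.coe_injective (by simpa using huv)
          rw [huv']
          exact exists_word_content_mul (Or.inl hd)
      | coe u =>
        cases v with
        | one =>
          have huv' : subOmega φ (letter c) = u * letter d :=
            WithOne.coe_injective (by simpa using huv)
          rw [huv']
          exact exists_word_content_mul (Or.inr hd)
        | coe v =>
          have huv' : subOmega φ (letter c) = u * letter d * v :=
            WithOne.coe_injective (by simpa using huv)
          rw [huv']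
          exact exists_word_content_mul (Or.inl (exists_word_content_mul (Or.inr hd)))
    obtain ⟨w, hw, hdw⟩ := hx
    obtain ⟨K, hK, hnK, hKc⟩ := exists_subOmega_coord φ (FinCon.content A) h.pos
    rw [hKc K hK dvd_rfl, letter, iterate_extend_word] at hw
    exact (h.mem_iff K (Nat.le_of_dvd hK hnK) c d).mp
      (((word_coord_eq_iff _ _ _).mp hw d).mp hdw)
  · obtain ⟨K, hK⟩ := h.exists_mul_mul (u := FreeSemigroup.of d) (h.singleton_mem_language hd)
    have : subOmega φ (word (FreeSemigroup.of d)) ∈ {x | ∃ u v, x = u * letter d * v} := by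
      refine subOmega_word_mem (isClosed_factor _) one_pos ⟨K, fun j hj => ?_⟩
      obtain ⟨p, q, hpq⟩ := hK (1 * j) (by omega) d
      exact ⟨word p, word q, by rw [hpq, map_mul, map_mul]; rfl⟩
    obtain ⟨u, v, huv⟩ := this
    exact ⟨d, u, v, by rw [letter, huv]; rfl⟩

/-- An ultimately group invertible substitution restricts to an automorphism of the free group on
the letters of the language, and so do its iterates. -/
theorem IsUniform.iterate_substHom (h : IsUniform φ B n) (hinv : IsUltimatelyGroupInvertible φ)
    (k : ℕ) : Set.BijOn (substHom φ)^[k] (letterSubgroup B) (letterSubgroup B) := by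
  rw [IsUltimatelyGroupInvertible, h.persistent_eq] at hinv
  have hmaps : Set.MapsTo (substHom φ) (letterSubgroup B) (letterSubgroup B) := by
    change letterSubgroup B ≤ (letterSubgroup B).comap (substHom φ)
    rw [letterSubgroup, Subgroup.closure_le]
    rintro _ ⟨c, hc, rfl⟩
    rw [SetLike.mem_coe, Subgroup.mem_comap, substHom_of, toGroup_eq_posWord]
    exact posWord_mem fun d hd => h.map_mem hc hd
  have hbij : Set.BijOn (substHom φ) (letterSubgroup B) (letterSubgroup B) :=
    ⟨hmaps, substHom_injOn hinv.injOn, substHom_surjOn hinv.surjOn⟩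
  exact hbij.iterate k

/-- The elements of the group lie in the images of all iterates of the substitution. -/
theorem IsUniform.exists_eq_extend_iter (h : IsUniform φ B n) (hinv : IsUltimatelyGroupInvertible φ)
    (hba : [b, a] ∈ language φ) {m : ℕ} (hm : FixesConnection φ b a m) {g : ProSemi A}
    (hg : g ∈ core (subOmega φ (letter a)) (subOmega φ (letter b))) (k : ℕ) :
    ∃ y, g = extend (iter φ k) y := by
  set σ : A → List A := fun c => letters (iter φ k (FreeSemigroup.of c)) with hσ
  obtain ⟨ℓ, hℓ⟩ := exists_length_bound (iter φ k)
  have hgrp : ∀ x, grpHom σ x = (substHom φ)^[k] x := fun x => by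
    rw [← substHom_iter, substHom_eq_grpHom]
  have hbij := h.iterate_substHom hinv k
  obtain ⟨C, hC⟩ := exists_common_cut (σ := σ) (B := B) (fun c => letters_ne_nil _)
    (fun t ht => by
      obtain ⟨τ, hτ, rfl⟩ := hbij.surjOn ht
      exact ⟨τ, hτ, hgrp τ⟩)
    (fun τ hτ τ' hτ' heq => hbij.injOn hτ hτ' (by rw [← hgrp, ← hgrp, heq])) hℓ
  have haB : a ∈ B := h.mem_of_language hba (by simp)
  have hT : IsClosed (Set.range (extend (iter φ k))) :=
    (isCompact_range (continuous_extend _)).isClosed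
  suffices hmem : g ∈ Set.range (extend (iter φ k)) by
    obtain ⟨y, hy⟩ := hmem
    exact ⟨y, hy.symm⟩
  refine mem_of_isClosed_of_coord hT fun c => ?_
  -- After at least `i` iterations, the image of a letter is longer than `C` and has all its letters
  -- in `B`.
  let i := (C + 1) * n + n
  obtain ⟨j, hj⟩ : ∃ j, k + i ≤ m * j := ⟨k + i, Nat.le_mul_of_pos_left _ hm.pos⟩
  obtain ⟨i', hi'⟩ : ∃ i', m * j = k + i' ∧ i ≤ i' := ⟨m * j - k, by omega, by omega⟩
  obtain ⟨x, N, s, t, hN, hxc, hNeq⟩ := h.exists_approx hba hm hg c j (k + i)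
  obtain ⟨N', hN'⟩ : ∃ N', N = k + N' ∧ i ≤ N' := ⟨N - k, by omega, by omega⟩
  have hblock : ∀ d, letters (iter φ (m * j) (FreeSemigroup.of d)) =
      (letters (iter φ i' (FreeSemigroup.of d))).flatMap σ := fun d => by
    rw [hi'.1, letters_iter_add]
  have hlen : ∀ d, C ≤ (letters (iter φ i' (FreeSemigroup.of d))).length := fun d =>
    (h.lt_length C i' (by
      have : (C + 1) * n = C * n + n := Nat.succ_mul C n
      have := hi'.2
      simp only [i] at this
      omega) d).le
  have hmemB : ∀ q, n ≤ q → ∀ d e, e ∈ letters (iter φ q (FreeSemigroup.of d)) → e ∈ B :=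
    fun q hq d e he => (h.mem_iff q hq d e).mp he
  have hni : n ≤ i := Nat.le_add_left n _
  have hword : letters (iter φ N (FreeSemigroup.of a)) =
      (letters (iter φ N' (FreeSemigroup.of a))).flatMap σ := by
    rw [hN'.1, letters_iter_add]
  have hV := hmemB N' (by omega) a
  have hVσ : ∀ e ∈ (letters (iter φ N' (FreeSemigroup.of a))).flatMap σ, e ∈ B := by
    rw [← hword]
    exact hmemB N (by omega) a
  have heq := hword
  rw [hNeq] at heq
  simp only [letters_mul, letters_of] at heq
  rw [hblock a, hblock b] at heq
  -- A cut inside the initial block that is also a cut of φ^N(a) = σ(φ^{N'}(a)); the next step finds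
  -- one in the final block.
  obtain ⟨u₁, v₁, hu₁, hv₁, hcut₁⟩ := hC (letters s ++ [b])
    (letters (iter φ i' (FreeSemigroup.of a)))
    (letters x ++ ((letters (iter φ i' (FreeSemigroup.of b))).flatMap σ ++ ([a] ++ letters t)))
    (letters (iter φ N' (FreeSemigroup.of a))) (hmemB i' (by omega) a) hV hVσ (hlen a)
    (by rw [← heq]; simp only [List.append_assoc])
  obtain ⟨u₂, v₂, hu₂, hv₂, hcut₂⟩ := hC
    (letters s ++ [b] ++ (letters (iter φ i' (FreeSemigroup.of a))).flatMap σ ++ letters x)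
    (letters (iter φ i' (FreeSemigroup.of b))) ([a] ++ letters t)
    (letters (iter φ N' (FreeSemigroup.of a))) (hmemB i' (by omega) b) hV hVσ (hlen b)
    (by rw [← heq]; simp only [List.append_assoc])
  obtain ⟨y, hy⟩ : v₁ <+: v₂ := by
    refine prefix_of_length_flatMap_lt (σ := σ) hv₁ hv₂ ?_
    have h1 := length_flatMap_prefix_le (σ := σ) hu₁
    have h2 := length_letters_pos x
    rw [← hcut₁, ← hcut₂]
    simp only [List.length_append]
    omega
  obtain ⟨u₃, hu₃⟩ := hu₂
  have hmid : (letters (iter φ i' (FreeSemigroup.of a))).flatMap σ ++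
      (letters x ++ u₂.flatMap σ) = u₁.flatMap σ ++ y.flatMap σ := by
    rw [← hy, List.flatMap_append, ← hcut₁] at hcut₂
    simpa only [List.append_assoc, List.append_cancel_left_eq] using hcut₂
  -- Outside the two common cuts the end blocks provide the desubstitution, between them the ambient
  -- word does.
  have hw : letters (iter φ (m * j) (FreeSemigroup.of a) * x * iter φ (m * j) (FreeSemigroup.of b)) =
      (u₁ ++ y ++ u₃).flatMap σ := by
    rw [letters_mul, letters_mul, hblock, hblock, ← hu₃]
    simp only [List.flatMap_append]
    rw [← hmid]
    simp only [List.append_assoc]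
  obtain ⟨w, hw'⟩ := exists_letters_eq (l := u₁ ++ y ++ u₃) (by
    intro h0
    rw [h0, List.flatMap_nil] at hw
    exact letters_ne_nil _ hw)
  refine ⟨word (iter φ k w), ⟨word w, extend_word _ _⟩, ?_⟩
  have hww : iter φ k w =
      iter φ (m * j) (FreeSemigroup.of a) * x * iter φ (m * j) (FreeSemigroup.of b) :=
    letters_injective (by rw [hw, letters_map, hw'])
  rw [hww, hxc]

/-- The elements of the group are fixed by `φ^ω`. -/
theorem IsUniform.subOmega_eq_self_of_mem_core (h : IsUniform φ B n)
    (hinv : IsUltimatelyGroupInvertible φ) (hba : [b, a] ∈ language φ) {m : ℕ}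
    (hm : FixesConnection φ b a m) {g : ProSemi A}
    (hg : g ∈ core (subOmega φ (letter a)) (subOmega φ (letter b))) : subOmega φ g = g :=
  subOmega_eq_self φ one_pos fun k _ _ => h.exists_eq_extend_iter hinv hba hm hg k

end Schutzenberger

/-! ### The presentation -/

section Presentation

variable {A : Type u}

/-- The homomorphism that sends a word over `X` to the pair of its values in the free profinite
semigroup on `A` and in the free profinite group on `X`. -/
def graphHom (X : Set (FreeSemigroup A)) : FreeSemigroup X →ₙ* ProSemi A × ProGrp X where
  toFun y := (word (inclX X y), gword (toGroup y))
  map_mul' y z := by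
    rw [map_mul, map_mul, map_mul, gword_mul]
    rfl

/-- The closed relation between the free profinite semigroup on `A` and the free profinite group on
`X` that is generated by `X`. -/
def graph (X : Set (FreeSemigroup A)) : Subsemigroup (ProSemi A × ProGrp X) :=
  (graphHom X).srange.topologicalClosure

variable {X : Set (FreeSemigroup A)}

theorem isClosed_graph : IsClosed (graph X : Set (ProSemi A × ProGrp X)) :=
  Subsemigroup.isClosed_topologicalClosure _

theorem graphHom_mem_graph (y : FreeSemigroup X) : (word (inclX X y), gword (toGroup y)) ∈ graph X :=
  subset_closure ⟨y, rfl⟩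

theorem exists_graphHom_mem {p : ProSemi A × ProGrp X} (hp : p ∈ graph X)
    {U : Set (ProSemi A)} (hU : IsOpen U) (h1 : p.1 ∈ U) (N : FiniteIndexNormalSubgroup (FreeGroup X)) :
    ∃ y, word (inclX X y) ∈ U ∧ gcoord N p.2 = (toGroup y : FreeGroup X) := by
  have hopen : IsOpen (U ×ˢ {z : ProGrp X | gcoord N z = gcoord N p.2}) :=
    hU.prod (isOpen_gcoord N _)
  obtain ⟨_, ⟨hq1, hq2⟩, y, rfl⟩ := mem_closure_iff.mp hp _ hopen ⟨h1, rfl⟩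
  exact ⟨y, hq1, hq2.symm⟩

theorem inclX_lift {φ : FreeSemigroup A →ₙ* FreeSemigroup A} {m : ℕ} {w : X → FreeSemigroup X}
    (hw : ∀ x, inclX X (w x) = φ^[m] x) (y : FreeSemigroup X) :
    inclX X (FreeSemigroup.lift w y) = iter φ m (inclX X y) := by
  induction y using FreeSemigroup.recOnMul with
  | ih1 x => exact hw x
  | ih2 x y h1 h2 => rw [map_mul, map_mul, map_mul, map_mul, h1, h2]

theorem toGroup_lift {X : Type u} (w : X → FreeSemigroup X) (y : FreeSemigroup X) :
    toGroup (FreeSemigroup.lift w y) = FreeGroup.lift (fun x => toGroup (w x)) (toGroup y) := by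
  induction y using FreeSemigroup.recOnMul with
  | ih1 x => exact FreeGroup.lift_apply_of.symm
  | ih2 x y h1 h2 => rw [map_mul, map_mul, map_mul, map_mul, h1, h2]

/-- The word φ^m(bxa) is in the language, and its factor φ^m(x) begins with a, ends with b, and
stands between b and a. -/
theorem FixesConnection.exists_inclX_iter {φ : FreeSemigroup A →ₙ* FreeSemigroup A} {a b : A}
    {m : ℕ} (hm : FixesConnection φ b a m) {x : FreeSemigroup A}
    (hx : x ∈ shiftedReturns φ b a) : ∃ y, inclX (shiftedReturns φ b a) y = iter φ m x := by
  obtain ⟨⟨l, hl⟩, ⟨l', hl'⟩, hL, -⟩ := mem_shiftedReturns_iff.mp hx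
  obtain ⟨p, hp⟩ := hm.2.1
  obtain ⟨q, hq⟩ := hm.2.2
  refine exists_inclX_eq _ ?_ ?_ ?_
  · rw [letters_map, hl, List.flatMap_cons, iter_apply φ m (FreeSemigroup.of a), ← hp]
    exact ⟨_, rfl⟩
  · rw [letters_map, hl', List.flatMap_append, List.flatMap_singleton,
      iter_apply φ m (FreeSemigroup.of b), ← hq, ← List.append_assoc]
    exact ⟨_, rfl⟩
  · refine language_infix ?_ (language_map hL m)
    rw [List.flatMap_append, List.flatMap_cons, List.flatMap_singleton,
      iter_apply φ m (FreeSemigroup.of a), iter_apply φ m (FreeSemigroup.of b), ← hp, ← hq,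
      ← letters_map]
    exact ⟨q, p, by simp⟩

variable [Finite A] {φ : FreeSemigroup A →ₙ* FreeSemigroup A} {B : Set A} {n : ℕ} {a b : A}

/-- The second component of an element of the relation is determined by the first. -/
theorem graph_unique (hfin : (shiftedReturns φ b a).Finite) {s : ProSemi A}
    {γ γ' : ProGrp (shiftedReturns φ b a)} (h : (s, γ) ∈ graph (shiftedReturns φ b a))
    (h' : (s, γ') ∈ graph (shiftedReturns φ b a)) : γ = γ' := by
  refine gcoord_ext fun N => ?_
  let Λ : FreeSemigroup (shiftedReturns φ b a) →ₙ*
      FreeGroup (shiftedReturns φ b a) ⧸ N.toSubgroup :=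
    { toFun := fun y => (toGroup y : FreeGroup _)
      map_mul' := fun y z => by rw [map_mul]; rfl }
  have : Finite (FreeGroup (shiftedReturns φ b a) ⧸ N.toSubgroup) :=
    Subgroup.finite_quotient_of_finiteIndex
  -- The quotient by `N` restricts to a homomorphism on X⁺ with finite image, so its values are
  -- already visible in a finite quotient of A⁺.
  obtain ⟨c, hc⟩ := exists_finCon_inclX hfin Λ
  obtain ⟨y, hy, hy'⟩ := exists_graphHom_mem h (isOpen_coord c (s.1 c)) rfl N
  obtain ⟨z, hz, hz'⟩ := exists_graphHom_mem h' (isOpen_coord c (s.1 c)) rfl N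
  have hyz : (word (inclX _ y)).1 c = (word (inclX _ z)).1 c := hy.trans hz.symm
  exact hy'.trans ((hc y z ((word_coord_eq_iff c _ _).mp hyz)).trans hz'.symm)

/-- The relation is invariant under the pair of φ^m and its lift to X; taking the powers n! and the
limit gives both ω-powers. -/
theorem graph_omega {X : Set (FreeSemigroup A)} [Finite X] {m : ℕ} (hm : 0 < m)
    {w : X → FreeSemigroup X} (hw : ∀ x, inclX X (w x) = φ^[m] x) {s : ProSemi A} {γ : ProGrp X}
    (h : (s, γ) ∈ graph X) : (subOmega φ s, omega (groupEndo w) γ) ∈ graph X := by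
  have hstep : ∀ p ∈ graph X, ((extend φ)^[m] p.1, groupEndo w p.2) ∈ graph X := by
    have hcont : Continuous fun p : ProSemi A × ProGrp X =>
        ((extend φ)^[m] p.1, groupEndo w p.2) :=
      (((continuous_extend φ).iterate m).comp continuous_fst).prodMk
        ((groupEndo w).continuous_toFun.comp continuous_snd)
    have hmaps : Set.MapsTo (fun p : ProSemi A × ProGrp X =>
        ((extend φ)^[m] p.1, groupEndo w p.2)) (graphHom X).srange (graphHom X).srange := by
      rintro _ ⟨y, rfl⟩
      refine ⟨FreeSemigroup.lift w y, ?_⟩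
      change (word (inclX X (FreeSemigroup.lift w y)), gword (toGroup (FreeSemigroup.lift w y))) =
        ((extend φ)^[m] (word (inclX X y)), groupEndo w (gword (toGroup y)))
      rw [inclX_lift hw, toGroup_lift, iterate_extend_word, groupEndo_gword]
    exact fun p hp => hmaps.closure hcont hp
  have hiter : ∀ k : ℕ, ((extend φ)^[m * k] s, (groupEndo w)^[k] γ) ∈ graph X := by
    intro k
    induction k with
    | zero => exact h
    | succ k ih =>
      have := hstep _ ih
      rw [Function.iterate_succ_apply', Nat.mul_succ, Nat.add_comm, Function.iterate_add_apply]
      exact this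
  exact isClosed_graph.mem_of_tendsto
    ((tendsto_subOmega φ hm s).prodMk_nhds (tendsto_omega_grp (groupEndo w) γ))
    (Eventually.of_forall fun k => hiter _)

/-- For each finite quotient of `A⁺` there is a finite quotient of the free group on `X` such that
the values of `φ^ω` in the former correspond to elements of the latter. -/
theorem IsUniform.exists_gcoord_iff (h : IsUniform φ B n) (hba : [b, a] ∈ language φ) {m : ℕ}
    (hm : FixesConnection φ b a m) (c : FinCon A) :
    ∃ N : FiniteIndexNormalSubgroup (FreeGroup (shiftedReturns φ b a)),
      ∀ p ∈ graph (shiftedReturns φ b a), ∀ q ∈ graph (shiftedReturns φ b a),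
        gcoord N p.2 = gcoord N q.2 ↔ (subOmega φ p.1).1 c = (subOmega φ q.1).1 c := by
  have hl := h.isLinked hba
  let _ := hl.group (h.core_nonempty hba hm)
  let G := core (subOmega φ (letter a)) (subOmega φ (letter b))
  let val : G →ₙ* FinQuot c := ⟨fun g => g.1.1 c, fun _ _ => rfl⟩
  have : Finite (Con.ker val).Quotient := by
    refine Finite.of_injective (β := FinQuot c) (Quotient.lift val fun _ _ h => h) ?_
    rintro ⟨x⟩ ⟨y⟩ hxy
    exact Quotient.sound hxy
  -- Because G is a group, x ↦ φ^ω(x) extends to the free group. Composing with the finite quotient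
  -- of G seen through `c` gives a finite-index kernel.
  let χ : FreeGroup (shiftedReturns φ b a) →* G :=
    FreeGroup.lift fun x => ⟨_, h.subOmega_inclX_mem_core hba (FreeSemigroup.of x)⟩
  have hχ : ∀ y, ((χ (toGroup y) : G) : ProSemi A) = subOmega φ (word (inclX _ y)) := by
    intro y
    induction y using FreeSemigroup.recOnMul with
    | ih1 x =>
      have : χ (toGroup (FreeSemigroup.of x)) =
        ⟨_, h.subOmega_inclX_mem_core hba (FreeSemigroup.of x)⟩ := FreeGroup.lift_apply_of
      rw [this]
    | ih2 x y h1 h2 =>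
      rw [map_mul, map_mul, map_mul, map_mul, subOmega_mul, ← h1, ← h2]
      rfl
  let π : FreeGroup (shiftedReturns φ b a) →* (Con.ker val).Quotient :=
    (Con.ker val).mk'.comp χ
  refine ⟨kerSubgroup π, fun p hp q hq => ?_⟩
  have hopen : ∀ x, IsOpen {z : ProSemi A | (subOmega φ z).1 c = x} := fun x =>
    (isOpen_coord c x).preimage (continuous_subOmega φ)
  obtain ⟨y, hy, hy'⟩ := exists_graphHom_mem hp (hopen ((subOmega φ p.1).1 c)) rfl (kerSubgroup π)
  obtain ⟨z, hz, hz'⟩ := exists_graphHom_mem hq (hopen ((subOmega φ q.1).1 c)) rfl (kerSubgroup π)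
  change (subOmega φ (word (inclX _ y))).1 c = _ at hy
  change (subOmega φ (word (inclX _ z))).1 c = _ at hz
  rw [hy', hz', ← hy, ← hz, ← hχ, ← hχ]
  refine (QuotientGroup.eq (s := π.ker)).trans ?_
  rw [MonoidHom.mem_ker, map_mul, map_inv, inv_mul_eq_one]
  exact (Con.ker val).eq

/-- The relation is compact, so its first projection is closed; it contains X⁺, hence also its
closure. -/
theorem IsUniform.exists_graph_mem (h : IsUniform φ B n) (hba : [b, a] ∈ language φ) {m : ℕ}
    (hm : FixesConnection φ b a m) {g : ProSemi A}
    (hg : g ∈ core (subOmega φ (letter a)) (subOmega φ (letter b))) :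
    ∃ γ, (g, γ) ∈ graph (shiftedReturns φ b a) := by
  have hclosed : IsClosed (Prod.fst '' (graph (shiftedReturns φ b a) :
      Set (ProSemi A × ProGrp (shiftedReturns φ b a)))) :=
    (isClosed_graph.isCompact.image continuous_fst).isClosed
  have hsub : closure (Set.range fun y => word (inclX (shiftedReturns φ b a) y)) ⊆
      Prod.fst '' (graph (shiftedReturns φ b a) :
      Set (ProSemi A × ProGrp (shiftedReturns φ b a))) := by
    refine closure_minimal ?_ hclosed
    rintro _ ⟨y, rfl⟩
    exact ⟨_, graphHom_mem_graph y, rfl⟩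
  obtain ⟨⟨_, γ⟩, hγ, rfl⟩ := hsub (h.core_subset_closure hba hm hg)
  exact ⟨γ, hγ⟩

theorem relSubgroup_le {X K : Type u} [Group K] {R : Set (ProGrp X)} (f : ProGrp X →* K)
    (hf : IsClosed (f.ker : Set (ProGrp X))) (hR : ∀ r ∈ R, f r = 1) : relSubgroup R ≤ f.ker :=
  Subgroup.topologicalClosure_minimal _ (Subgroup.normalClosure_le_normal hR) hf

theorem IsUniform.hasPresentation (h : IsUniform φ B n) (hinv : IsUltimatelyGroupInvertible φ)
    (hba : [b, a] ∈ language φ) {m : ℕ} (hm : FixesConnection φ b a m)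
    {w : shiftedReturns φ b a → FreeSemigroup (shiftedReturns φ b a)}
    (hw : ∀ x, inclX (shiftedReturns φ b a) (w x) = φ^[m] x) :
    HasPresentation (omegaRelators (groupEndo w))
      (core (subOmega φ (letter a)) (subOmega φ (letter b)))
      (fun x : shiftedReturns φ b a => subOmega φ (word x)) := by
  have hfin := h.finite_shiftedReturns hba
  have : Finite (shiftedReturns φ b a) := hfin.to_subtype
  have hl := h.isLinked hba
  let G := core (subOmega φ (letter a)) (subOmega φ (letter b))
  let _ : Group G := hl.group (h.core_nonempty hba hm)
  let R := omegaRelators (groupEndo w)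
  have hGc : CompactSpace G := isCompact_iff_compactSpace.mp (isClosed_core _ _).isCompact
  have hrel : IsClosed (relSubgroup R : Set (ProGrp (shiftedReturns φ b a))) :=
    Subgroup.isClosed_topologicalClosure _
  choose γ hγ using fun g : G => h.exists_graph_mem hba hm g.2
  have hγ_eq : ∀ (g : G) δ, (g.1, δ) ∈ graph (shiftedReturns φ b a) → γ g = δ := fun g δ hδ =>
    graph_unique hfin (hγ g) hδ
  have hγ_mul : ∀ g g' : G, γ (g * g') = γ g * γ g' := fun g g' =>
    hγ_eq _ _ (mul_mem (hγ g) (hγ g'))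
  -- Closed graph theorem for compact spaces.
  have hγ_cont : Continuous γ := by
    rw [continuous_iff_isClosed]
    intro Z hZ
    have hc : IsClosed (Prod.fst '' ((graph (shiftedReturns φ b a) :
      Set (ProSemi A × ProGrp (shiftedReturns φ b a))) ∩ Prod.snd ⁻¹' Z)) :=
      ((isClosed_graph.inter (hZ.preimage continuous_snd)).isCompact.image continuous_fst).isClosed
    convert! hc.preimage (continuous_subtype_val (p := (· ∈ G)))
    ext g
    constructor
    · exact fun hg => ⟨(g.1, γ g), ⟨hγ g, hg⟩, rfl⟩
    · rintro ⟨⟨_, δ⟩, ⟨h1, h2⟩, rfl⟩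
      rw [Set.mem_preimage, hγ_eq g δ h1]
      exact h2
  let f : G →* ProGrp (shiftedReturns φ b a) ⧸ relSubgroup R :=
    (QuotientGroup.mk' (relSubgroup R)).comp (MonoidHom.mk' γ hγ_mul)
  have hf_cont : Continuous f := continuous_quotient_mk'.comp hγ_cont
  have hfix : ∀ g : G, subOmega φ g.1 = g.1 := fun g =>
    h.subOmega_eq_self_of_mem_core hinv hba hm g.2
  let gen : shiftedReturns φ b a → G := fun x =>
    ⟨_, h.subOmega_inclX_mem_core hba (FreeSemigroup.of x)⟩
  have hgraph_of : ∀ x : shiftedReturns φ b a,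
      (word x.1, gword (FreeGroup.of x)) ∈ graph (shiftedReturns φ b a) := fun x =>
    graphHom_mem_graph (FreeSemigroup.of x)
  -- The pair (x, x) is carried to (φ^ω(x), Φ^ω(x)), and Φ^ω(x) is x modulo the relators.
  have hgen : ∀ x, f (gen x) = QuotientGroup.mk (gword (FreeGroup.of x)) := by
    intro x
    have h1 : γ (gen x) = omega (groupEndo w) (gword (FreeGroup.of x)) :=
      hγ_eq _ _ (graph_omega hm.pos hw (hgraph_of x))
    change (QuotientGroup.mk (γ (gen x)) : ProGrp _ ⧸ relSubgroup R) = _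
    rw [h1, ← mul_inv_eq_one, ← QuotientGroup.mk_inv, ← QuotientGroup.mk_mul,
      QuotientGroup.eq_one_iff]
    exact subset_closure (Subgroup.subset_normalClosure ⟨x, rfl⟩)
  have hinj : Function.Injective f := by
    intro g g' hgg'
    have h1 : (γ g)⁻¹ * γ g' ∈ relSubgroup R := QuotientGroup.eq.mp hgg'
    apply Subtype.ext
    rw [← hfix g, ← hfix g']
    refine coord_ext fun c => ?_
    obtain ⟨N, hN⟩ := h.exists_gcoord_iff hba hm c
    refine (hN _ (hγ g) _ (hγ g')).mp ?_
    -- The pairs (φ^ω(x), Φ^ω(x)) and (x, x) have first components with the same φ^ω-image, so `N`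
    -- does not separate their second components.
    have hle : relSubgroup R ≤ (gcoord N).ker := by
      refine relSubgroup_le _ ?_ ?_
      · exact Subgroup.isClosed_of_isOpen _ (isOpen_gcoord N 1)
      · rintro _ ⟨x, rfl⟩
        rw [map_mul, map_inv, mul_inv_eq_one]
        refine (hN _ (graph_omega hm.pos hw (hgraph_of x)) _ (hgraph_of x)).mpr ?_
        simp only [subOmega_idem]
    have h2 := hle h1
    rwa [MonoidHom.mem_ker, map_mul, map_inv, inv_mul_eq_one] at h2
  -- The image is compact and contains the generators, hence the dense image of the free group.
  have hsurj : Function.Surjective f := by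
    have hclosed : IsClosed (Set.range f) := (isCompact_range hf_cont).isClosed
    let q : FreeGroup (shiftedReturns φ b a) →* ProGrp (shiftedReturns φ b a) ⧸ relSubgroup R :=
      (QuotientGroup.mk' (relSubgroup R)).comp ⟨⟨gword, rfl⟩, gword_mul⟩
    have hq : ∀ y, q y ∈ Set.range f := by
      have h1 : (⊤ : Subgroup (FreeGroup (shiftedReturns φ b a))) ≤ f.range.comap q := by
        rw [← FreeGroup.closure_range_of, Subgroup.closure_le]
        rintro _ ⟨x, rfl⟩
        exact ⟨gen x, hgen x⟩
      exact fun y => h1 (Subgroup.mem_top y)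
    have hdense : DenseRange q :=
      (QuotientGroup.mk'_surjective _).denseRange.comp
        (ProfiniteGrp.ProfiniteCompletion.denseRange (GrpCat.of (FreeGroup _)))
        continuous_quotient_mk'
    have : closure (Set.range q) ⊆ Set.range f :=
      closure_minimal (Set.range_subset_iff.mpr hq) hclosed
    intro z
    exact this (hdense z)
  let e : G ≃ₜ (ProGrp (shiftedReturns φ b a) ⧸ relSubgroup R) :=
    Continuous.homeoOfEquivCompactToT2 (f := Equiv.ofBijective f ⟨hinj, hsurj⟩) hf_cont
  have he : ∀ g, e g = f g := fun _ => rfl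
  refine ⟨e.symm, fun p q => ?_, fun x => ?_⟩
  · have h1 : e.symm (p * q) = e.symm p * e.symm q := by
      rw [Homeomorph.symm_apply_eq, he, map_mul, ← he, ← he, Homeomorph.apply_symm_apply,
        Homeomorph.apply_symm_apply]
    rw [h1]
    rfl
  · rw [← hgen x, ← he, Homeomorph.symm_apply_apply]
    rfl

end Presentation

end Subst

theorem theoremt {A : Type u} [Finite A] (φ : FreeSemigroup A →ₙ* FreeSemigroup A)
    (hφ : Subst.IsWeaklyPrimitive φ) (hinv : Subst.IsUltimatelyGroupInvertible φ)
    (b a : A) (hba : Subst.IsConnection φ b a) :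
    (Subst.shiftedReturns φ b a).Finite ∧
    Function.Injective (Subst.inclX (Subst.shiftedReturns φ b a)) ∧
    (∃ m : ℕ, Subst.FixesConnection φ b a m) ∧
    ∀ m : ℕ, Subst.FixesConnection φ b a m →
      ∃ w : Subst.shiftedReturns φ b a → FreeSemigroup (Subst.shiftedReturns φ b a),
        (∀ x, Subst.inclX (Subst.shiftedReturns φ b a) (w x) = φ^[m] x) ∧
        Subst.HasPresentation
          (Subst.omegaRelators (Subst.groupEndo w))
          (Subst.schutzenbergerGroup φ b a)
          (fun x => Subst.subOmega φ (Subst.word x)) := by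
  obtain ⟨B, n, h⟩ := hφ.exists_isUniform
  have hL := hba.1
  have hfin := h.finite_shiftedReturns hL
  refine ⟨hfin, Subst.inclX_injective hfin, Subst.exists_fixesConnection hba, fun m hm => ?_⟩
  choose w hw using fun x : Subst.shiftedReturns φ b a => hm.exists_inclX_iter x.2
  refine ⟨w, hw, ?_⟩
  rw [h.schutzenbergerGroup_eq hL]
  exact h.hasPresentation hinv hL hm hw
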